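/- Let $V$ be a real inner product space of finite dimension $n$, and let $\mathcal{P}(V)$ be the set of convex polytopes in $V$ (of any dimension, including $\varnothing$). Let $K_{\mathcal{P}}(V)$ be the quotient of the free abelian group on $\mathcal{P}(V)$ by the relations $[\varnothing]=0$; $[C\cup C']+[C\cap C']=[C]+[C']$ whenever $C,C',C\cup C'\in\mathcal{P}(V)$; and $[g(C)]=[C]$ for every $C\in\mathcal{P}(V)$ and every affine isometry $g$ of $V$. The map $C\mapsto[C]$ extends uniquely to a valuation on the relative Boolean algebra $\mathcal{P}_{\mathrm{ext}}(V)$ generated by $\mathcal{P}(V)$ (the smallest collection of subsets of $V$ containing $\mathcal{P}(V)$ and closed under finite unions, finite intersections and set differences), so the class $[P]\in K_{\mathcal{P}}(V)$ is defined for every $P\in\mathcal{P}_{\mathrm{ext}}(V)$. Let $K_{\mathcal{Z}}(V)$ be the subgroup of $K_{\mathcal{P}}(V)$ generated by the classes of the translates of parallelotopes $\{\sum_{i=1}^r a_iv_i : 0\le a_i\le 1\}$, where $r\ge 0$ and $(v_1,\dots,v_r)$ is a linearly independent list in $V$, and let $\mathcal{Z}_{\mathrm{ext}}(V)$ be the set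 of $P\in\mathcal{P}_{\mathrm{ext}}(V)$ with $[P]\in K_{\mathcal{Z}}(V)$. Let $V_0,\dots,V_n$ be the intrinsic volumes, determined for compact convex $K\subseteq V$ by Steiner's formula $\mathrm{vol}(K+\rho B)=\sum_{j=0}^n\kappa_{n-j}V_j(K)\rho^{n-j}$ for $\rho\ge 0$, where $B$ is the closed unit ball of $V$ and $\kappa_k$ is the volume of the unit ball of $\mathbb{R}^k$. They induce group morphisms $V_j:K_{\mathcal{P}}(V)\to\mathbb{R}$, and for $P\in\mathcal{P}_{\mathrm{ext}}(V)$ we write $V_j(P)=V_j([P])$. **Theorem.** On $K_{\mathcal{Z}}(V)$ the morphism $V_0$ takes values in $\mathbb{Z}$, and $$(V_0,V_1,\dots,V_n):K_{\mathcal{Z}}(V)\longrightarrow\mathbb{Z}\times\mathbb{R}^n$$ is an isomorphism of groups. In particular, if $P,P'\in\mathcal{Z}_{\mathrm{ext}}(V)$ satisfy $V_i(P)=V_i(P')$ for every $0\le i\le n$, then $[P]=[P']$ in $K_{\mathcal{Z}}(V)$. -/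

import Mathlib

noncomputable section

namespace Dissection

open scoped Pointwise

section DissectionGroup

variable {V : Type*} [NormedAddCommGroup V] [InnerProductSpace ℝ V]

/-- The relations defining the dissection group of a family `𝒞` of subsets of `V`: the class of
the empty set is zero, classes are additive on unions that stay in the family, and classes are
invariant under affine isometries. -/
def dissectionRelations (𝒞 : Set (Set V)) : Set (FreeAbelianGroup 𝒞) :=
  {x | (∃ C : 𝒞, (C : Set V) = ∅ ∧ x = FreeAbelianGroup.of C) ∨
    (∃ C C' U I : 𝒞, (U : Set V) = (C : Set V) ∪ (C' : Set V) ∧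
      (I : Set V) = (C : Set V) ∩ (C' : Set V) ∧
      x = FreeAbelianGroup.of U + FreeAbelianGroup.of I
        - (FreeAbelianGroup.of C + FreeAbelianGroup.of C')) ∨
    (∃ (g : V ≃ᵃⁱ[ℝ] V) (C D : 𝒞), (D : Set V) = g '' (C : Set V) ∧
      x = FreeAbelianGroup.of D - FreeAbelianGroup.of C)}

/-- The abstract dissection group of a family `𝒞` of subsets of `V`. -/
abbrev DissectionGroup (𝒞 : Set (Set V)) : Type _ :=
  FreeAbelianGroup 𝒞 ⧸ AddSubgroup.closure (dissectionRelations 𝒞)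

/-- The class `[C]` of a member of the family. -/
def cls {𝒞 : Set (Set V)} (C : 𝒞) : DissectionGroup 𝒞 :=
  QuotientAddGroup.mk (FreeAbelianGroup.of C)

theorem cls_empty {𝒞 : Set (Set V)} (C : 𝒞) (h : (C : Set V) = ∅) : cls C = 0 :=
  (QuotientAddGroup.eq_zero_iff _).2 (AddSubgroup.subset_closure (Or.inl ⟨C, h, rfl⟩))

theorem cls_union {𝒞 : Set (Set V)} (C C' U I : 𝒞) (hU : (U : Set V) = (C : Set V) ∪ (C' : Set V))
    (hI : (I : Set V) = (C : Set V) ∩ (C' : Set V)) : cls U + cls I = cls C + cls C' := by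
  rw [← sub_eq_zero]
  exact (QuotientAddGroup.eq_zero_iff _).2
    (AddSubgroup.subset_closure (Or.inr (Or.inl ⟨C, C', U, I, hU, hI, rfl⟩)))

/-- The relative Boolean algebra generated by a family of sets. -/
inductive RelBool (𝒞 : Set (Set V)) : Set V → Prop
  | base (C : Set V) : C ∈ 𝒞 → RelBool 𝒞 C
  | union (S T : Set V) : RelBool 𝒞 S → RelBool 𝒞 T → RelBool 𝒞 (S ∪ T)
  | inter (S T : Set V) : RelBool 𝒞 S → RelBool 𝒞 T → RelBool 𝒞 (S ∩ T)
  | diff (S T : Set V) : RelBool 𝒞 S → RelBool 𝒞 T → RelBool 𝒞 (S \ T)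

/-- The closed half-space `{x | ⟪a, x⟫ ≤ b}` (all of `V` or empty if `a = 0`). -/
def halfSpace (a : V) (b : ℝ) : Set V := {x | inner ℝ a x ≤ b}

variable (V) in
/-- The convex polytopes of `V`, of any dimension and including the empty one: the bounded sets
that are intersections of finitely many closed half-spaces. -/
def polytopes : Set (Set V) :=
  {C | Bornology.IsBounded C ∧ ∃ s : Finset (V × ℝ), C = ⋂ h ∈ s, halfSpace h.1 h.2}

theorem mem_halfSpace (a : V) (b : ℝ) (x : V) : x ∈ halfSpace a b ↔ inner ℝ a x ≤ b := Iff.rfl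

theorem convex_halfSpace (a : V) (b : ℝ) : Convex ℝ (halfSpace a b) :=
  convex_halfSpace_le (f := fun x => inner ℝ a x)
    ⟨fun x y => inner_add_right a x y, fun c x => inner_smul_right a x c⟩ b

theorem isClosed_halfSpace (a : V) (b : ℝ) : IsClosed (halfSpace a b) :=
  isClosed_le (by fun_prop) continuous_const

theorem polytope_convex {C : Set V} (hC : C ∈ polytopes V) : Convex ℝ C := by
  obtain ⟨-, s, rfl⟩ := hC
  exact convex_iInter₂ fun h _ => convex_halfSpace _ _

theorem polytope_isClosed {C : Set V} (hC : C ∈ polytopes V) : IsClosed C := by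
  obtain ⟨-, s, rfl⟩ := hC
  exact isClosed_biInter fun h _ => isClosed_halfSpace _ _

theorem polytope_inter {C D : Set V} (hC : C ∈ polytopes V) (hD : D ∈ polytopes V) :
    C ∩ D ∈ polytopes V := by
  classical
  obtain ⟨hb, s, rfl⟩ := hC
  obtain ⟨-, t, rfl⟩ := hD
  refine ⟨hb.subset Set.inter_subset_left, s ∪ t, ?_⟩
  ext x
  simp only [Set.mem_inter_iff, Set.mem_iInter, Finset.mem_union, or_imp, forall_and]

theorem polytope_inter_halfSpace {C : Set V} (hC : C ∈ polytopes V) (a : V) (b : ℝ) :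
    C ∩ halfSpace a b ∈ polytopes V := by
  classical
  obtain ⟨hb, s, rfl⟩ := hC
  refine ⟨hb.subset Set.inter_subset_left, insert (a, b) s, ?_⟩
  rw [Finset.set_biInter_insert, Set.inter_comm]

theorem empty_mem_polytopes : (∅ : Set V) ∈ polytopes V := by
  refine ⟨Bornology.isBounded_empty, {(0, -1)}, ?_⟩
  ext x
  simp [mem_halfSpace]

/-- The hypotheses on a function `φ` of polytopes and a convex set `Ω` that make the induction in
the extension theorem work: `φ` is additive under cutting by a hyperplane, and it depends only
on the trace of a polytope on `Ω`. -/
structure Cuttable {A : Type*} [AddCommGroup A] (φ : Set V → A) (Ω : Set V) : Prop where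
  convex : Convex ℝ Ω
  empty : φ ∅ = 0
  split : ∀ C ∈ polytopes V, ∀ (a : V) (b : ℝ),
    φ (C ∩ halfSpace a b) + φ (C ∩ halfSpace (-a) (-b)) =
      φ C + φ (C ∩ halfSpace a b ∩ halfSpace (-a) (-b))
  trace : ∀ C ∈ polytopes V, ∀ D ∈ polytopes V, C ∩ Ω = D ∩ Ω → φ C = φ D

theorem Cuttable.eq {A : Type*} [AddCommGroup A] {φ : Set V → A} {Ω : Set V}
    (h : Cuttable φ Ω) (a : V) (b : ℝ) :
    Cuttable (fun C => φ (C ∩ halfSpace a b ∩ halfSpace (-a) (-b)))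
      (Ω ∩ {x | inner ℝ a x = b}) where
  convex := h.convex.inter (convex_hyperplane (f := fun x => inner ℝ a x)
    ⟨fun x y => inner_add_right a x y, fun c x => inner_smul_right a x c⟩ b)
  empty := by simpa using h.empty
  split C hC a' b' := by
    have := h.split _ (polytope_inter_halfSpace (polytope_inter_halfSpace hC a b) (-a) (-b)) a' b'
    convert this using 3 <;> (ext x; simp only [Set.mem_inter_iff]; tauto)
  trace C hC D hD hCD := by
    refine h.trace _ (polytope_inter_halfSpace (polytope_inter_halfSpace hC _ _) _ _) _
      (polytope_inter_halfSpace (polytope_inter_halfSpace hD _ _) _ _) ?_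
    ext x
    have hx := Set.ext_iff.1 hCD x
    simp only [Set.mem_inter_iff, mem_halfSpace, inner_neg_left, neg_le_neg_iff,
      Set.mem_ofPred_eq] at hx ⊢
    constructor
    · rintro ⟨⟨⟨h1, h2⟩, h3⟩, h4⟩
      exact ⟨⟨⟨(hx.1 ⟨h1, h4, le_antisymm h2 h3⟩).1, h2⟩, h3⟩, h4⟩
    · rintro ⟨⟨⟨h1, h2⟩, h3⟩, h4⟩
      exact ⟨⟨⟨(hx.2 ⟨h1, h4, le_antisymm h2 h3⟩).1, h2⟩, h3⟩, h4⟩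

theorem trace_closure {Ω C D : Set V} (hΩ : Convex ℝ Ω) (hC : Convex ℝ C) (hD : IsClosed D)
    (a : V) (b : ℝ) (hCD : C ∩ (Ω ∩ {x | inner ℝ a x < b}) ⊆ D)
    (hne : (C ∩ (Ω ∩ {x | inner ℝ a x < b})).Nonempty) :
    C ∩ halfSpace a b ∩ Ω ⊆ D := by
  obtain ⟨p, hpC, hpΩ, hp⟩ := hne
  rintro q ⟨⟨hqC, hq⟩, hqΩ⟩
  have hsub : openSegment ℝ p q ⊆ D := by
    rintro _ ⟨s, t, hs, ht, hst, rfl⟩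
    refine hCD ⟨hC hpC hqC hs.le ht.le hst, hΩ hpΩ hqΩ hs.le ht.le hst, ?_⟩
    simp only [Set.mem_ofPred_eq, inner_add_right, inner_smul_right] at hp ⊢
    have hq' : inner ℝ a q ≤ b := hq
    have h1 := mul_lt_mul_of_pos_left hp hs
    have h2 := mul_le_mul_of_nonneg_left hq' ht.le
    calc _ < s * b + t * b := add_lt_add_of_lt_of_le h1 h2
      _ = b := by rw [← add_mul, hst, one_mul]
  have : closure (openSegment ℝ p q) ⊆ D := hD.closure_subset_iff.2 hsub
  rw [closure_openSegment] at this
  exact this (right_mem_segment ℝ p q)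

theorem Cuttable.lt {A : Type*} [AddCommGroup A] {φ : Set V → A} {Ω : Set V}
    (h : Cuttable φ Ω) (a : V) (b : ℝ) :
    Cuttable (fun C => φ (C ∩ halfSpace a b) - φ (C ∩ halfSpace a b ∩ halfSpace (-a) (-b)))
      (Ω ∩ {x | inner ℝ a x < b}) where
  convex := h.convex.inter (convex_halfSpace_lt (f := fun x => inner ℝ a x)
    ⟨fun x y => inner_add_right a x y, fun c x => inner_smul_right a x c⟩ b)
  empty := by simp
  split C hC a' b' := by
    have h1 := h.split _ (polytope_inter_halfSpace hC a b) a' b'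
    have h2 := h.split _
      (polytope_inter_halfSpace (polytope_inter_halfSpace hC a b) (-a) (-b)) a' b'
    have e : ∀ S T U : Set V, S ∩ T ∩ U = S ∩ U ∩ T := Set.inter_right_comm
    rw [e C (halfSpace a' b') (halfSpace a b), e C (halfSpace (-a') (-b')) (halfSpace a b),
      e (C ∩ halfSpace a' b') (halfSpace (-a') (-b')) (halfSpace a b),
      e C (halfSpace a' b') (halfSpace a b),
      e (C ∩ halfSpace a b) (halfSpace a' b') (halfSpace (-a) (-b)),
      e (C ∩ halfSpace a b) (halfSpace (-a') (-b')) (halfSpace (-a) (-b)),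
      e (C ∩ halfSpace a b ∩ halfSpace a' b') (halfSpace (-a') (-b')) (halfSpace (-a) (-b)),
      e (C ∩ halfSpace a b) (halfSpace a' b') (halfSpace (-a) (-b))]
    rw [sub_add_sub_comm, h1, h2, add_sub_add_comm]
  trace C hC D hD hCD := by
    have hle : ∀ {E : Set V}, E ∈ polytopes V → E ∩ halfSpace a b ∈ polytopes V :=
      fun hE => polytope_inter_halfSpace hE _ _
    have hge : ∀ {E : Set V}, E ∈ polytopes V →
      E ∩ halfSpace a b ∩ halfSpace (-a) (-b) ∈ polytopes V :=
      fun hE => polytope_inter_halfSpace (hle hE) _ _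
    by_cases hne : (C ∩ (Ω ∩ {x | inner ℝ a x < b})).Nonempty
    · have hCD1 := trace_closure h.convex (polytope_convex hC) (polytope_isClosed hD) a b
        (by rw [hCD]; exact Set.inter_subset_left) hne
      have hDC1 := trace_closure h.convex (polytope_convex hD) (polytope_isClosed hC) a b
        (by rw [← hCD]; exact Set.inter_subset_left) (by rwa [← hCD])
      have e1 : C ∩ halfSpace a b ∩ Ω = D ∩ halfSpace a b ∩ Ω := by
        ext x
        exact ⟨fun hx => ⟨⟨hCD1 hx, hx.1.2⟩, hx.2⟩, fun hx => ⟨⟨hDC1 hx, hx.1.2⟩, hx.2⟩⟩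
      rw [h.trace _ (hle hC) _ (hle hD) e1, h.trace _ (hge hC) _ (hge hD)]
      rw [Set.inter_right_comm, e1, Set.inter_right_comm]
    · have aux : ∀ E : Set V, E ∈ polytopes V → ¬ (E ∩ (Ω ∩ {x | inner ℝ a x < b})).Nonempty →
          φ (E ∩ halfSpace a b) - φ (E ∩ halfSpace a b ∩ halfSpace (-a) (-b)) = 0 := by
        intro E hE hEn
        rw [sub_eq_zero]
        refine h.trace _ (hle hE) _ (hge hE) ?_
        ext x
        simp only [Set.mem_inter_iff, mem_halfSpace, inner_neg_left, neg_le_neg_iff]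
        refine ⟨fun hx => ⟨⟨hx.1, ?_⟩, hx.2⟩, fun hx => ⟨hx.1.1, hx.2⟩⟩
        by_contra hlt
        exact hEn ⟨x, hx.1.1, hx.2, not_le.1 hlt⟩
      rw [aux C hC hne, aux D hD (by rwa [← hCD])]

theorem Cuttable.sum_eq_zero {A : Type*} [AddCommGroup A] {ι : Type*} (s : Finset ι)
    (c : ι → ℤ) (C : ι → Set V) (hC : ∀ i ∈ s, C i ∈ polytopes V) (L : List (V × ℝ)) :
    ∀ (φ : Set V → A) (Ω : Set V), Cuttable φ Ω →
      (∀ i ∈ s, ∀ x ∈ Ω, ∀ y ∈ Ω, (∀ h ∈ L, ((inner ℝ h.1 x < h.2 ↔ inner ℝ h.1 y < h.2) ∧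
        (inner ℝ h.1 x = h.2 ↔ inner ℝ h.1 y = h.2))) → x ∈ C i → y ∈ C i) →
      (∀ x ∈ Ω, ∑ i ∈ s, c i * (C i).indicator 1 x = 0) →
      ∑ i ∈ s, c i • φ (C i) = 0 := by
  induction L with
  | nil =>
    intro φ Ω hφ hsep hsum
    by_cases hne : Ω.Nonempty
    · obtain ⟨x, hx⟩ := hne
      have hΩ : ∀ i ∈ s, x ∈ C i → C i ∩ Ω = Ω := fun i hi hxi =>
        Set.inter_eq_right.2 fun y hy => hsep i hi x hx y hy (by simp) hxi
      have hΩ' : ∀ i ∈ s, x ∉ C i → φ (C i) = 0 := by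
        intro i hi hxi
        rw [← hφ.empty]
        refine hφ.trace _ (hC i hi) _ empty_mem_polytopes ?_
        rw [Set.empty_inter, Set.eq_empty_iff_forall_notMem]
        exact fun y hy => hxi (hsep i hi y hy.2 x hx (by simp) hy.1)
      by_cases hex : ∃ i ∈ s, x ∈ C i
      · obtain ⟨j, hj, hxj⟩ := hex
        have : ∀ i ∈ s, c i • φ (C i) = (c i * (C i).indicator 1 x) • φ (C j) := by
          intro i hi
          by_cases hxi : x ∈ C i
          · rw [hφ.trace _ (hC i hi) _ (hC j hj) (by rw [hΩ i hi hxi, hΩ j hj hxj])]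
            simp [hxi]
          · rw [hΩ' i hi hxi]; simp [hxi]
        rw [Finset.sum_congr rfl this, ← Finset.sum_smul, hsum x hx, zero_smul]
      · push Not at hex
        exact Finset.sum_eq_zero fun i hi => by rw [hΩ' i hi (hex i hi), smul_zero]
    · refine Finset.sum_eq_zero fun i hi => ?_
      rw [hφ.trace _ (hC i hi) _ empty_mem_polytopes, hφ.empty, smul_zero]
      rw [Set.not_nonempty_iff_eq_empty.1 hne]; simp
  | cons h L ih =>
    obtain ⟨a, b⟩ := h
    intro φ Ω hφ hsep hsum
    have h1 := ih _ _ (hφ.lt a b)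
      (by
        intro i hi x hx y hy hL
        refine hsep i hi x hx.1 y hy.1 fun h hh => ?_
        rcases List.mem_cons.1 hh with rfl | hh
        · have hx2 : inner ℝ a x < b := hx.2
          have hy2 : inner ℝ a y < b := hy.2
          simp [hx2, hy2, hx2.ne, hy2.ne]
        · exact hL h hh)
      (fun x hx => hsum x hx.1)
    have h2 := ih _ _ (hφ.eq a b)
      (by
        intro i hi x hx y hy hL
        refine hsep i hi x hx.1 y hy.1 fun h hh => ?_
        rcases List.mem_cons.1 hh with rfl | hh
        · have hx2 : inner ℝ a x = b := hx.2
          have hy2 : inner ℝ a y = b := hy.2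
          simp [hx2, hy2]
        · exact hL h hh)
      (fun x hx => hsum x hx.1)
    have h3 := ih _ _ (hφ.lt (-a) (-b))
      (by
        intro i hi x hx y hy hL
        refine hsep i hi x hx.1 y hy.1 fun h hh => ?_
        rcases List.mem_cons.1 hh with rfl | hh
        · have hx2 : b < inner ℝ a x := by simpa [inner_neg_left] using hx.2
          have hy2 : b < inner ℝ a y := by simpa [inner_neg_left] using hy.2
          simp [hx2.not_gt, hy2.not_gt, hx2.ne', hy2.ne']
        · exact hL h hh)
      (fun x hx => hsum x hx.1)
    have key : ∀ i ∈ s, c i • φ (C i) =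
        c i • (φ (C i ∩ halfSpace a b) - φ (C i ∩ halfSpace a b ∩ halfSpace (-a) (-b))) +
        c i • φ (C i ∩ halfSpace a b ∩ halfSpace (-a) (-b)) +
        c i • (φ (C i ∩ halfSpace (-a) (-b)) -
          φ (C i ∩ halfSpace (-a) (-b) ∩ halfSpace (- -a) (- -b))) := by
      intro i hi
      have := hφ.split _ (hC i hi) a b
      rw [← smul_add, ← smul_add, neg_neg, neg_neg,
        Set.inter_right_comm (C i) (halfSpace (-a) (-b)) (halfSpace a b)]
      congr 1
      rw [← eq_sub_iff_add_eq] at this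
      rw [this]; abel
    rw [Finset.sum_congr rfl key, Finset.sum_add_distrib, Finset.sum_add_distrib, h1, h2, h3]
    simp

variable (V) in
/-- The map sending a formal combination of polytopes to the same combination of their
indicator functions. -/
def indicatorHom : FreeAbelianGroup (polytopes V) →+ (V → ℤ) :=
  FreeAbelianGroup.lift fun C => (C : Set V).indicator 1

variable (V) in
/-- The dissection group of the convex polytopes of `V`. -/
abbrev PolytopeGroup : Type _ := DissectionGroup (polytopes V)

/-- **Groemer's theorem** for polytopes: a linear relation between indicator functions of polytopes
holds between their classes. -/
theorem mk_eq_zero_of_indicatorHom_eq_zero (x : FreeAbelianGroup (polytopes V))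
    (hx : indicatorHom V x = 0) : (QuotientAddGroup.mk x : PolytopeGroup V) = 0 := by
  classical
  let φ : Set V → PolytopeGroup V := fun C => if h : C ∈ polytopes V then cls ⟨C, h⟩ else 0
  have hφ : ∀ C : polytopes V, φ C = cls C := fun C => dif_pos C.2
  have hcut : Cuttable φ Set.univ := by
    refine ⟨convex_univ, ?_, ?_, ?_⟩
    · rw [hφ ⟨∅, empty_mem_polytopes⟩]; exact cls_empty _ rfl
    · intro C hC a b
      have e1 := polytope_inter_halfSpace hC a b
      have e2 := polytope_inter_halfSpace hC (-a) (-b)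
      have e3 := polytope_inter_halfSpace e1 (-a) (-b)
      rw [hφ ⟨_, e1⟩, hφ ⟨_, e2⟩, hφ ⟨_, e3⟩, hφ ⟨_, hC⟩]
      refine (cls_union _ _ _ _ ?_ ?_).symm
      · ext y
        simp only [Set.mem_union, Set.mem_inter_iff, mem_halfSpace, inner_neg_left,
          neg_le_neg_iff]
        have := le_total (inner ℝ a y) b
        tauto
      · ext y
        simp only [Set.mem_inter_iff]
        tauto
    · intro C _ D _ h
      rw [Set.inter_univ, Set.inter_univ] at h
      rw [h]
  obtain ⟨σ, f, hxf⟩ : ∃ (σ : Finset (polytopes V)) (f : polytopes V → ℤ),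
      x = ∑ C ∈ σ, f C • FreeAbelianGroup.of C :=
    ⟨x.support, fun C => FreeAbelianGroup.coeff C x,
      FreeAbelianGroup.eq_sum_support_coeff_smul_of x⟩
  choose! t ht using fun C : polytopes V => C.2.2
  have main := Cuttable.sum_eq_zero σ f (fun C => (C : Set V)) (fun C _ => C.2)
    (σ.biUnion t).toList φ Set.univ hcut
    (by
      intro C hC x _ y _ hL hxC
      rw [ht C] at hxC ⊢
      simp only [Set.mem_iInter, mem_halfSpace] at hxC ⊢
      intro h hh
      have h1 := hL h (by rw [Finset.mem_toList, Finset.mem_biUnion]; exact ⟨C, hC, hh⟩)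
      rcases (hxC h hh).lt_or_eq with h2 | h2
      · exact (h1.1.1 h2).le
      · exact (h1.2.1 h2).le)
    (by
      intro y _
      have := congrFun hx y
      rw [hxf] at this
      simpa [indicatorHom, map_sum, Finset.sum_apply] using this)
  rw [hxf]
  have : (QuotientAddGroup.mk (∑ C ∈ σ, f C • FreeAbelianGroup.of C) : PolytopeGroup V) =
      ∑ C ∈ σ, f C • cls C := by
    rw [← QuotientAddGroup.mk'_apply, map_sum]
    exact Finset.sum_congr rfl fun C _ => map_zsmul _ _ _
  rw [this, ← main]
  exact Finset.sum_congr rfl fun C _ => by rw [hφ]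

theorem indicator_mul_mem_range {f g : V → ℤ} (hf : f ∈ (indicatorHom V).range)
    (hg : g ∈ (indicatorHom V).range) : f * g ∈ (indicatorHom V).range := by
  obtain ⟨x, rfl⟩ := hf
  obtain ⟨y, rfl⟩ := hg
  induction x using FreeAbelianGroup.induction_on with
  | zero => rw [map_zero, zero_mul]; exact zero_mem _
  | of C =>
    induction y using FreeAbelianGroup.induction_on with
    | zero => rw [map_zero, mul_zero]; exact zero_mem _
    | of D =>
      refine ⟨FreeAbelianGroup.of ⟨_, polytope_inter C.2 D.2⟩, ?_⟩
      simp only [indicatorHom, FreeAbelianGroup.lift_apply_of]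
      ext v
      by_cases h1 : v ∈ (C : Set V) <;> by_cases h2 : v ∈ (D : Set V) <;> simp [h1, h2]
    | neg D h => rw [map_neg, mul_neg]; exact neg_mem h
    | add y z hy hz => rw [map_add, mul_add]; exact add_mem hy hz
  | neg C h => rw [map_neg, neg_mul]; exact neg_mem h
  | add y z hy hz => rw [map_add, add_mul]; exact add_mem hy hz

/-- The indicator function of a member of the relative Boolean algebra generated by the polytopes
is an integral combination of indicator functions of polytopes. -/
theorem RelBool.exists_indicatorHom {S : Set V} (hS : RelBool (polytopes V) S) :
    ∃ x, indicatorHom V x = S.indicator 1 := by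
  change S.indicator 1 ∈ (indicatorHom V).range
  have hinter : ∀ S T : Set V, S.indicator (1 : V → ℤ) ∈ (indicatorHom V).range →
      T.indicator (1 : V → ℤ) ∈ (indicatorHom V).range →
      (S ∩ T).indicator (1 : V → ℤ) ∈ (indicatorHom V).range := by
    intro S T hS hT
    convert! indicator_mul_mem_range hS hT using 1
    ext v
    by_cases h1 : v ∈ S <;> by_cases h2 : v ∈ T <;> simp [h1, h2]
  induction hS with
  | base C hC => exact ⟨FreeAbelianGroup.of ⟨C, hC⟩, by simp [indicatorHom]⟩
  | union S T _ _ hS hT =>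
    have e : (S ∪ T).indicator (1 : V → ℤ) =
        S.indicator 1 + T.indicator 1 - (S ∩ T).indicator 1 := by
      rw [eq_sub_iff_add_eq]
      exact Set.indicator_union_add_inter _ _ _
    rw [e]
    exact sub_mem (add_mem hS hT) (hinter S T hS hT)
  | inter S T _ _ hS hT => exact hinter S T hS hT
  | diff S T _ _ hS hT =>
    have e : (S \ T).indicator (1 : V → ℤ) = S.indicator 1 - (S ∩ T).indicator 1 := by
      ext v
      by_cases h1 : v ∈ S <;> by_cases h2 : v ∈ T <;> simp [h1, h2]
    rw [e]
    exact sub_mem hS (hinter S T hS hT)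

open Classical in
/-- The class `[S]` of a member `S` of the relative Boolean algebra generated by the polytopes:
if `∑ cᵢ 1_{Cᵢ} = 1_S` with polytopes `Cᵢ` and integers `cᵢ`, then `[S] = ∑ cᵢ [Cᵢ]`. This is the
unique extension of `C ↦ [C]` to a valuation on that algebra, see `extClass_eq`,
`extClass_polytope` and `extClass_union_add_inter`. -/
def extClass (S : Set V) : PolytopeGroup V :=
  if h : ∃ x, indicatorHom V x = S.indicator 1 then QuotientAddGroup.mk h.choose else 0

theorem extClass_eq {S : Set V} {x : FreeAbelianGroup (polytopes V)}
    (hx : indicatorHom V x = S.indicator 1) : extClass S = QuotientAddGroup.mk x := by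
  have h : ∃ x, indicatorHom V x = S.indicator 1 := ⟨x, hx⟩
  rw [extClass, dif_pos h, ← sub_eq_zero, ← QuotientAddGroup.mk_sub]
  refine mk_eq_zero_of_indicatorHom_eq_zero _ ?_
  rw [map_sub, h.choose_spec, hx, sub_self]

theorem extClass_polytope (C : polytopes V) : extClass (C : Set V) = cls C :=
  extClass_eq (by simp [indicatorHom])

theorem extClass_union_add_inter {S T : Set V} (hS : RelBool (polytopes V) S)
    (hT : RelBool (polytopes V) T) :
    extClass (S ∪ T) + extClass (S ∩ T) = extClass S + extClass T := by
  obtain ⟨x, hx⟩ := hS.exists_indicatorHom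
  obtain ⟨y, hy⟩ := hT.exists_indicatorHom
  obtain ⟨z, hz⟩ := (hS.inter _ _ hT).exists_indicatorHom
  have hu : indicatorHom V (x + y - z) = (S ∪ T).indicator 1 := by
    rw [map_sub, map_add, hx, hy, hz, sub_eq_iff_eq_add]
    exact (Set.indicator_union_add_inter _ _ _).symm
  rw [extClass_eq hx, extClass_eq hy, extClass_eq hz, extClass_eq hu,
    ← QuotientAddGroup.mk_add, ← QuotientAddGroup.mk_add, sub_add_cancel]

end DissectionGroup

section NormalCones

variable {V : Type*} [NormedAddCommGroup V] [InnerProductSpace ℝ V]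

/-- The points of `⋂ h ∈ s, halfSpace h.1 h.2` where exactly the constraints in `I` are active. -/
def activeFace (s I : Finset (V × ℝ)) : Set V :=
  {y | (∀ h ∈ s, inner ℝ h.1 y ≤ h.2) ∧ ∀ h ∈ s, (inner ℝ h.1 y = h.2 ↔ h ∈ I)}

/-- The cone of outer normals at the points where exactly the constraints in `I` are active. -/
def normalCone (I : Finset (V × ℝ)) : Set V :=
  {z | ∀ d : V, (∀ h ∈ I, inner ℝ h.1 d ≤ 0) → inner ℝ z d ≤ 0}

theorem convex_activeFace (s I : Finset (V × ℝ)) : Convex ℝ (activeFace s I) := by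
  intro y hy z hz p q hp hq hpq
  have key : ∀ h ∈ s, inner ℝ h.1 (p • y + q • z) - h.2 =
      p * (inner ℝ h.1 y - h.2) + q * (inner ℝ h.1 z - h.2) := by
    intro h _
    rw [inner_add_right, inner_smul_right, inner_smul_right]
    linear_combination h.2 * hpq
  have hy' : ∀ h ∈ s, inner ℝ h.1 y - h.2 ≤ 0 := fun h hh => sub_nonpos.2 (hy.1 h hh)
  have hz' : ∀ h ∈ s, inner ℝ h.1 z - h.2 ≤ 0 := fun h hh => sub_nonpos.2 (hz.1 h hh)
  refine ⟨fun h hh => ?_, fun h hh => ⟨fun he => ?_, fun hI => ?_⟩⟩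
  · have := key h hh
    nlinarith [hy' h hh, hz' h hh]
  · have hk := key h hh
    rw [he, sub_self] at hk
    have h1 := mul_nonpos_of_nonneg_of_nonpos hp (hy' h hh)
    have h2 := mul_nonpos_of_nonneg_of_nonpos hq (hz' h hh)
    rcases hp.eq_or_lt with rfl | hp'
    · rw [zero_add] at hpq
      subst hpq
      exact (hz.2 h hh).1 (by linarith)
    · have : p * (inner ℝ h.1 y - h.2) = 0 := by linarith
      rcases mul_eq_zero.1 this with h3 | h3
      · exact absurd h3 hp'.ne'
      · exact (hy.2 h hh).1 (by linarith)
  · have hk := key h hh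
    rw [(hy.2 h hh).2 hI, (hz.2 h hh).2 hI] at hk
    linarith

theorem convex_normalCone (I : Finset (V × ℝ)) : Convex ℝ (normalCone I) := by
  intro y hy z hz p q hp hq _ d hd
  rw [inner_add_left, inner_smul_left, inner_smul_left]
  have h1 := mul_nonpos_of_nonneg_of_nonpos hp (hy d hd)
  have h2 := mul_nonpos_of_nonneg_of_nonpos hq (hz d hd)
  simpa using add_nonpos h1 h2

/-- Every outer normal vector at a point of the active face lies in the normal cone, and
conversely. -/
theorem mem_normalCone_iff {s I : Finset (V × ℝ)} {y : V} (hy : y ∈ activeFace s I) (hI : I ⊆ s)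
    (z : V) : z ∈ normalCone I ↔ ∀ w ∈ ⋂ h ∈ s, halfSpace h.1 h.2, inner ℝ z (w - y) ≤ 0 := by
  simp only [Set.mem_iInter, mem_halfSpace]
  constructor
  · intro hz w hw
    refine hz _ fun h hh => ?_
    rw [inner_sub_right, (hy.2 h (hI hh)).2 hh]
    exact sub_nonpos.2 (hw h (hI hh))
  · intro hz d hd
    have hev : ∀ᶠ ε in nhdsWithin (0 : ℝ) (Set.Ioi 0),
        ∀ h ∈ s, inner ℝ h.1 (y + ε • d) ≤ h.2 := by
      rw [Filter.eventually_all_finset]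
      intro h hh
      by_cases hhI : h ∈ I
      · filter_upwards [self_mem_nhdsWithin] with ε hε
        rw [inner_add_right, inner_smul_right, (hy.2 h hh).2 hhI]
        have := mul_nonpos_of_nonneg_of_nonpos (le_of_lt hε) (hd h hhI)
        linarith
      · have hlt : inner ℝ h.1 y < h.2 :=
          lt_of_le_of_ne (hy.1 h hh) fun he => hhI ((hy.2 h hh).1 he)
        have hc : Continuous fun ε : ℝ => inner ℝ h.1 (y + ε • d) := by fun_prop
        have : ∀ᶠ ε in nhds (0 : ℝ), inner ℝ h.1 (y + ε • d) < h.2 :=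
          hc.continuousAt.eventually_lt continuousAt_const (by simpa using hlt)
        exact (this.filter_mono nhdsWithin_le_nhds).mono fun ε hε => hε.le
    obtain ⟨ε, hε, hpos⟩ := (hev.and self_mem_nhdsWithin).exists
    have h1 := hz _ hε
    rw [add_sub_cancel_left, inner_smul_right] at h1
    exact nonpos_of_mul_nonpos_right h1 hpos

end NormalCones

section IntrinsicVolumes

open MeasureTheory Module Metric

variable {V : Type*} [NormedAddCommGroup V] [InnerProductSpace ℝ V] [FiniteDimensional ℝ V]
  [MeasurableSpace V] [BorelSpace V]

theorem det_scaleAlong (W : Submodule ℝ V) (ρ : ℝ) :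
    LinearMap.det (LinearMap.id + (ρ - 1) • (W.starProjection : V →ₗ[ℝ] V)) =
      ρ ^ finrank ℝ W := by
  let e := W.prodEquivOfIsCompl Wᗮ W.isCompl_orthogonal
  have h : LinearMap.id + (ρ - 1) • (W.starProjection : V →ₗ[ℝ] V) =
      (e : (W × Wᗮ) →ₗ[ℝ] V) ∘ₗ ((ρ • LinearMap.id).prodMap LinearMap.id) ∘ₗ
        (e.symm : V →ₗ[ℝ] W × Wᗮ) := by
    rw [← LinearMap.comp_assoc, LinearEquiv.eq_comp_toLinearMap_symm]
    ext x
    · simp [e, Submodule.starProjection_eq_self_iff.2 x.2, sub_smul]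
    · have : W.starProjection (x : V) = 0 := by
        rw [Submodule.starProjection_apply,
          Submodule.orthogonalProjectionOnto_apply_of_mem_orthogonal x.2]
        rfl
      simp [e, this]
  rw [h, LinearMap.det_conj, LinearMap.det_prodMap, LinearMap.det_smul]
  simp

theorem volume_add_cone (W : Submodule ℝ V) (D N : Set V) (y₀ : V)
    (hD : ∀ y ∈ D, y - y₀ ∈ Wᗮ) (hN : ∀ z ∈ N, z ∈ W)
    (hcone : ∀ c : ℝ, 0 ≤ c → ∀ z ∈ N, c • z ∈ N) (h0 : (0 : V) ∈ N) (ρ : ℝ) (hρ : 0 ≤ ρ) :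
    volume.real (D + (N ∩ closedBall 0 ρ)) =
      ρ ^ finrank ℝ W * volume.real (D + (N ∩ closedBall 0 1)) := by
  let T : V →ₗ[ℝ] V := LinearMap.id + (ρ - 1) • (W.starProjection : V →ₗ[ℝ] V)
  have hT : ∀ y ∈ D, ∀ z ∈ N, T (-y₀ + (y + z)) = -y₀ + (y + ρ • z) := by
    intro y hy z hz
    have h1 : W.starProjection (y - y₀) = 0 := by
      rw [Submodule.starProjection_apply,
        Submodule.orthogonalProjectionOnto_apply_of_mem_orthogonal (hD y hy)]
      rfl
    have h2 : W.starProjection z = z := Submodule.starProjection_eq_self_iff.2 (hN z hz)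
    have h3 : -y₀ + (y + z) = (y - y₀) + z := by abel
    rw [h3]
    have h4 : T ((y - y₀) + z) = (y - y₀) + z +
        (ρ - 1) • (W.starProjection (y - y₀) + W.starProjection z) := by
      rw [← map_add]; rfl
    rw [h4, h1, h2, zero_add, sub_smul, one_smul]
    abel
  have himg : -y₀ +ᵥ (D + (N ∩ closedBall 0 ρ)) = T '' (-y₀ +ᵥ (D + (N ∩ closedBall 0 1))) := by
    ext x
    constructor
    · rintro ⟨_, ⟨y, hy, z, ⟨hz, hzρ⟩, rfl⟩, rfl⟩
      rw [mem_closedBall_zero_iff] at hzρ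
      obtain ⟨w, hw, hw1, rfl⟩ : ∃ w ∈ N, ‖w‖ ≤ 1 ∧ ρ • w = z := by
        rcases hρ.eq_or_lt with rfl | hpos
        · exact ⟨0, h0, by simp, by simpa using (norm_le_zero_iff.1 hzρ).symm⟩
        · refine ⟨ρ⁻¹ • z, hcone _ (inv_nonneg.2 hρ) z hz, ?_, smul_inv_smul₀ hpos.ne' z⟩
          rw [norm_smul, norm_inv, Real.norm_of_nonneg hρ, inv_mul_le_iff₀ hpos, mul_one]
          exact hzρ
      refine ⟨-y₀ + (y + w), ⟨y + w, ⟨y, hy, w, ⟨hw, ?_⟩, rfl⟩, rfl⟩, hT y hy w hw⟩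
      simpa using hw1
    · rintro ⟨_, ⟨_, ⟨y, hy, z, ⟨hz, hz1⟩, rfl⟩, rfl⟩, rfl⟩
      refine ⟨y + ρ • z, ⟨y, hy, ρ • z, ⟨hcone ρ hρ z hz, ?_⟩, rfl⟩, (hT y hy z hz).symm⟩
      rw [mem_closedBall_zero_iff] at hz1 ⊢
      rw [norm_smul, Real.norm_of_nonneg hρ]
      exact mul_le_of_le_one_right hρ hz1
  have h1 := congrArg volume himg
  rw [measure_vadd, Measure.addHaar_image_linearMap, det_scaleAlong, measure_vadd] at h1
  rw [measureReal_def, h1, ENNReal.toReal_mul, ENNReal.toReal_ofReal (abs_nonneg _),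
    abs_of_nonneg (pow_nonneg hρ _), measureReal_def]

theorem add_closedBall_eq_iUnion (s : Finset (V × ℝ)) (ρ : ℝ) :
    (⋂ h ∈ s, halfSpace h.1 h.2) + closedBall (0 : V) ρ =
      ⋃ I ∈ s.powerset, (activeFace s I + (normalCone I ∩ closedBall 0 ρ)) := by
  classical
  set C : Set V := ⋂ h ∈ s, halfSpace h.1 h.2 with hCdef
  have hmem : ∀ y, y ∈ C ↔ ∀ h ∈ s, inner ℝ h.1 y ≤ h.2 := by
    intro y; simp only [hCdef, Set.mem_iInter, mem_halfSpace]
  have hcl : IsClosed C := isClosed_biInter fun h _ => isClosed_halfSpace _ _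
  have hcv : Convex ℝ C := convex_iInter₂ fun h _ => convex_halfSpace _ _
  ext x
  simp only [Set.mem_iUnion, Finset.mem_powerset]
  constructor
  · rintro ⟨c, hc, b, hb, rfl⟩
    obtain ⟨y, hyC, hy⟩ := exists_norm_eq_iInf_of_complete_convex ⟨c, hc⟩ hcl.isComplete hcv (c + b)
    have hproj := (norm_eq_iInf_iff_real_inner_le_zero hcv hyC).1 hy
    let I := s.filter fun h => inner ℝ h.1 y = h.2
    have hyI : y ∈ activeFace s I := ⟨(hmem y).1 hyC, fun h hh => by simp [I, hh]⟩
    have hI : I ⊆ s := Finset.filter_subset _ _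
    refine ⟨I, hI, y, hyI, c + b - y, ⟨(mem_normalCone_iff hyI hI _).2 hproj, ?_⟩,
      add_sub_cancel _ _⟩
    rw [mem_closedBall_zero_iff] at hb ⊢
    rw [hy]
    refine le_trans (ciInf_le ⟨0, ?_⟩ (⟨c, hc⟩ : C)) ?_
    · rintro _ ⟨w, rfl⟩
      exact norm_nonneg _
    · simpa using hb
  · rintro ⟨I, -, y, hy, z, ⟨-, hz⟩, rfl⟩
    exact ⟨y, (hmem y).2 hy.1, z, hz, rfl⟩

theorem disjoint_pieces (s I J : Finset (V × ℝ)) (hI : I ⊆ s) (hJ : J ⊆ s) (hIJ : I ≠ J)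
    (ρ : ℝ) : Disjoint (activeFace s I + (normalCone I ∩ closedBall (0 : V) ρ))
      (activeFace s J + (normalCone J ∩ closedBall (0 : V) ρ)) := by
  rw [Set.disjoint_left]
  rintro _ ⟨y, hy, z, ⟨hz, -⟩, rfl⟩ ⟨y', hy', z', ⟨hz', -⟩, he⟩
  have he' : y' + z' = y + z := he
  have h1 := (mem_normalCone_iff hy hI z).1 hz y'
    (by simp only [Set.mem_iInter, mem_halfSpace]; exact hy'.1)
  have h2 := (mem_normalCone_iff hy' hJ z').1 hz' y
    (by simp only [Set.mem_iInter, mem_halfSpace]; exact hy.1)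
  have h3 : y' - y = z - z' := by
    rw [sub_eq_sub_iff_add_eq_add, he', add_comm]
  have h4 : inner ℝ (y' - y) (y' - y) ≤ 0 := by
    nth_rewrite 1 [h3]
    rw [inner_sub_left]
    have : inner ℝ z' (y' - y) = - inner ℝ z' (y - y') := by
      rw [← inner_neg_right, neg_sub]
    rw [this]
    linarith
  have h5 : y' = y := by
    rw [real_inner_self_eq_norm_sq] at h4
    exact sub_eq_zero.1 (norm_eq_zero.1 (pow_eq_zero_iff two_ne_zero |>.1
      (le_antisymm h4 (sq_nonneg _))))
  subst h5
  refine hIJ (Finset.ext fun h => ⟨fun hh => ?_, fun hh => ?_⟩)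
  · exact (hy'.2 h (hI hh)).1 ((hy.2 h (hI hh)).2 hh)
  · exact (hy.2 h (hJ hh)).1 ((hy'.2 h (hJ hh)).2 hh)

theorem volume_piece (s I : Finset (V × ℝ)) (hI : I ⊆ s) :
    ∃ (k : ℕ) (r : ℝ), k ≤ finrank ℝ V ∧ ∀ ρ : ℝ, 0 ≤ ρ →
      volume.real (activeFace s I + (normalCone I ∩ closedBall (0 : V) ρ)) = ρ ^ k * r := by
  by_cases hne : (activeFace s I).Nonempty
  · obtain ⟨y₀, hy₀⟩ := hne
    let W : Submodule ℝ V := Submodule.span ℝ (Prod.fst '' (I : Set (V × ℝ)))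
    refine ⟨finrank ℝ W, _, W.finrank_le, volume_add_cone W _ _ y₀ ?_ ?_ ?_ ?_⟩
    · intro y hy
      rw [Submodule.mem_orthogonal]
      intro u hu
      induction hu using Submodule.span_induction with
      | mem u hu =>
        obtain ⟨h, hh, rfl⟩ := hu
        rw [inner_sub_right, (hy.2 h (hI hh)).2 hh, (hy₀.2 h (hI hh)).2 hh, sub_self]
      | zero => exact inner_zero_left _
      | add u v _ _ hu hv => rw [inner_add_left, hu, hv, add_zero]
      | smul c u _ hu => rw [inner_smul_left, hu, mul_zero]
    · intro z hz
      rw [← Submodule.orthogonal_orthogonal W, Submodule.mem_orthogonal]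
      intro d hd
      have h0 : ∀ h ∈ I, inner ℝ h.1 d = 0 := fun h hh =>
        (Submodule.mem_orthogonal W d).1 hd _ (Submodule.subset_span ⟨h, hh, rfl⟩)
      have h1 := hz d fun h hh => (h0 h hh).le
      have h2 := hz (-d) fun h hh => by rw [inner_neg_right, h0 h hh, neg_zero]
      rw [inner_neg_right] at h2
      rw [real_inner_comm]
      linarith
    · intro c hc z hz d hd
      rw [inner_smul_left]
      exact mul_nonpos_of_nonneg_of_nonpos hc (hz d hd)
    · intro d _
      rw [inner_zero_left]
  · rw [Set.not_nonempty_iff_eq_empty.1 hne]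
    exact ⟨0, 0, Nat.zero_le _, fun ρ _ => by simp⟩

/-- `IsSteinerPolynomial K p` says that `p` computes the volumes of the parallel bodies of `K`. -/
def IsSteinerPolynomial (K : Set V) (p : Polynomial ℝ) : Prop :=
  ∀ ρ : ℝ, 0 ≤ ρ → volume.real (K + closedBall (0 : V) ρ) = p.eval ρ

/-- **Steiner's formula** for polytopes. -/
theorem exists_isSteinerPolynomial {C : Set V} (hC : C ∈ polytopes V) :
    ∃ p : Polynomial ℝ, p.natDegree ≤ finrank ℝ V ∧ IsSteinerPolynomial C p := by
  obtain ⟨hb, s, rfl⟩ := hC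
  choose! k r hk hr using fun (I : Finset (V × ℝ)) (hI : I ∈ s.powerset) =>
    volume_piece s I (Finset.mem_powerset.1 hI)
  refine ⟨∑ I ∈ s.powerset, Polynomial.C (r I) * Polynomial.X ^ k I, ?_, fun ρ hρ => ?_⟩
  · refine Polynomial.natDegree_sum_le_of_forall_le _ _ fun I hI => ?_
    exact (Polynomial.natDegree_C_mul_X_pow_le _ _).trans (hk I hI)
  · have hfin : ∀ I ∈ s.powerset,
        volume (activeFace s I + (normalCone I ∩ closedBall (0 : V) ρ)) ≠ ⊤ := by
      intro I hI
      refine (Bornology.IsBounded.measure_lt_top ?_).ne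
      have hb' := hb.add (isBounded_closedBall (x := (0 : V)) (r := ρ))
      rw [add_closedBall_eq_iUnion] at hb'
      exact hb'.subset (Set.subset_biUnion_of_mem
        (u := fun I => activeFace s I + (normalCone I ∩ closedBall (0 : V) ρ)) hI)
    rw [add_closedBall_eq_iUnion, measureReal_biUnion_finset₀ _ _ hfin]
    · rw [Polynomial.eval_finsetSum]
      refine Finset.sum_congr rfl fun I hI => ?_
      rw [hr I hI ρ hρ]
      rw [Polynomial.eval_mul, Polynomial.eval_C, Polynomial.eval_pow, Polynomial.eval_X, mul_comm]
    · intro I hI J hJ hIJ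
      exact (disjoint_pieces s I J (Finset.mem_powerset.1 hI) (Finset.mem_powerset.1 hJ)
        hIJ ρ).aedisjoint
    · intro I _
      exact ((convex_activeFace s I).add
        ((convex_normalCone I).inter (convex_closedBall _ _))).nullMeasurableSet volume

theorem IsSteinerPolynomial.unique {K : Set V} {p q : Polynomial ℝ}
    (hp : IsSteinerPolynomial K p) (hq : IsSteinerPolynomial K q) : p = q := by
  refine Polynomial.eq_of_infinite_eval_eq p q ((Set.Ici_infinite (0 : ℝ)).mono fun ρ hρ => ?_)
  exact (hp ρ hρ).symm.trans (hq ρ hρ)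

/-- The volume of the `k`-dimensional Euclidean unit ball. -/
def ballVolume (k : ℕ) : ℝ := volume.real (closedBall (0 : EuclideanSpace ℝ (Fin k)) 1)

open Classical in
/-- The `j`-th intrinsic volume `V_j(K)` of a compact convex set `K ⊆ V`, for
`0 ≤ j ≤ n = dim V`, defined by Steiner's formula
`vol (K + ρ B) = ∑ j, κ_{n-j} V_j(K) ρ^{n-j}` for `ρ ≥ 0`. -/
def intrinsicVolume (j : ℕ) (K : Set V) : ℝ :=
  if h : ∃ p, IsSteinerPolynomial K p then
    h.choose.coeff (finrank ℝ V - j) / ballVolume (finrank ℝ V - j) else 0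

theorem IsSteinerPolynomial.intrinsicVolume_eq {K : Set V} {p : Polynomial ℝ}
    (hp : IsSteinerPolynomial K p) (j : ℕ) :
    intrinsicVolume j K = p.coeff (finrank ℝ V - j) / ballVolume (finrank ℝ V - j) := by
  have h : ∃ p, IsSteinerPolynomial K p := ⟨p, hp⟩
  rw [intrinsicVolume, dif_pos h, h.choose_spec.unique hp]

theorem ballVolume_pos (k : ℕ) : 0 < ballVolume k :=
  ENNReal.toReal_pos (measure_closedBall_pos volume 0 one_pos).ne'
    (isCompact_closedBall _ _).measure_ne_top

/-- Steiner's formula in terms of the intrinsic volumes. -/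
theorem steiner_formula {C : Set V} (hC : C ∈ polytopes V) {ρ : ℝ} (hρ : 0 ≤ ρ) :
    volume.real (C + closedBall (0 : V) ρ) = ∑ j ∈ Finset.range (finrank ℝ V + 1),
      ballVolume (finrank ℝ V - j) * intrinsicVolume j C * ρ ^ (finrank ℝ V - j) := by
  obtain ⟨p, hdeg, hp⟩ := exists_isSteinerPolynomial hC
  rw [hp ρ hρ, p.eval_eq_sum_range' (Nat.lt_succ_of_le hdeg), ← Finset.sum_range_reflect]
  refine Finset.sum_congr rfl fun j _ => ?_
  rw [hp.intrinsicVolume_eq, mul_div_cancel₀ _ (ballVolume_pos _).ne']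
  simp

theorem intrinsicVolume_empty (j : ℕ) : intrinsicVolume j (∅ : Set V) = 0 := by
  have : IsSteinerPolynomial (∅ : Set V) 0 := fun ρ _ => by simp
  rw [this.intrinsicVolume_eq]; simp

theorem intrinsicVolume_union_add_inter (j : ℕ) {C C' : Set V} (hC : C ∈ polytopes V)
    (hC' : C' ∈ polytopes V) (hU : C ∪ C' ∈ polytopes V) :
    intrinsicVolume j (C ∪ C') + intrinsicVolume j (C ∩ C') =
      intrinsicVolume j C + intrinsicVolume j C' := by
  obtain ⟨p, -, hp⟩ := exists_isSteinerPolynomial hC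
  obtain ⟨p', -, hp'⟩ := exists_isSteinerPolynomial hC'
  obtain ⟨u, -, hu⟩ := exists_isSteinerPolynomial hU
  obtain ⟨i, -, hi⟩ := exists_isSteinerPolynomial (polytope_inter hC hC')
  have hcomp : ∀ {D : Set V}, D ∈ polytopes V → ∀ ρ : ℝ, IsCompact (D + closedBall (0 : V) ρ) :=
    fun hD ρ => (isCompact_of_isClosed_isBounded (polytope_isClosed hD) hD.1).add
      (isCompact_closedBall 0 ρ)
  have key : i = p + p' - u := by
    refine hi.unique fun ρ hρ => ?_
    have hint : (C ∩ C') + closedBall (0 : V) ρ =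
        (C + closedBall (0 : V) ρ) ∩ (C' + closedBall (0 : V) ρ) := by
      refine Set.Subset.antisymm (Set.inter_add_subset) ?_
      rintro _ ⟨⟨c, hc, b, hb, rfl⟩, ⟨c', hc', b', hb', he⟩⟩
      have he' : c' + b' = c + b := he
      obtain ⟨m, hm, hmC, hmC'⟩ := isPreconnected_closed_iff.1
        (convex_segment c c').isPreconnected C C' (polytope_isClosed hC) (polytope_isClosed hC')
        ((polytope_convex hU).segment_subset (Or.inl hc) (Or.inr hc'))
        ⟨c, left_mem_segment ℝ c c', hc⟩ ⟨c', right_mem_segment ℝ c c', hc'⟩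
      obtain ⟨s, t, hs, ht, hst, rfl⟩ := hm
      refine ⟨_, ⟨hmC, hmC'⟩, s • b + t • b', convex_closedBall _ _ hb hb' hs ht hst, ?_⟩
      calc s • c + t • c' + (s • b + t • b') = s • (c + b) + t • (c' + b') := by
            rw [smul_add, smul_add]; abel
        _ = c + b := by rw [he', ← add_smul, hst, one_smul]
    have h1 := measureReal_union_add_inter (μ := volume) (s := C + closedBall (0 : V) ρ)
      (hcomp hC' ρ).measurableSet (hcomp hC ρ).measure_ne_top (hcomp hC' ρ).measure_ne_top
    rw [← Set.union_add, ← hint, hp ρ hρ, hp' ρ hρ, hu ρ hρ] at h1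
    rw [Polynomial.eval_sub, Polynomial.eval_add]
    linarith
  rw [hp.intrinsicVolume_eq, hp'.intrinsicVolume_eq, hu.intrinsicVolume_eq,
    hi.intrinsicVolume_eq, key, Polynomial.coeff_sub, Polynomial.coeff_add]
  ring

theorem intrinsicVolume_image (j : ℕ) (g : V ≃ᵃⁱ[ℝ] V) (C : Set V) :
    intrinsicVolume j (g '' C) = intrinsicVolume j C := by
  have hvol : ∀ ρ : ℝ, volume.real (g '' C + closedBall (0 : V) ρ) =
      volume.real (C + closedBall (0 : V) ρ) := by
    intro ρ
    have himg : g '' C + closedBall (0 : V) ρ =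
        g 0 +ᵥ (g.linearIsometryEquiv '' (C + closedBall (0 : V) ρ)) := by
      have hg : ∀ x, g x = g 0 + g.linearIsometryEquiv x := by
        intro x
        have := g.map_vadd 0 x
        simpa [add_comm] using this
      ext x
      constructor
      · rintro ⟨_, ⟨c, hc, rfl⟩, b, hb, rfl⟩
        refine ⟨_, ⟨c + g.linearIsometryEquiv.symm b, ⟨c, hc, _, ?_, rfl⟩, rfl⟩, ?_⟩
        · simpa using hb
        · simp [hg c, add_assoc]
      · rintro ⟨_, ⟨_, ⟨c, hc, b, hb, rfl⟩, rfl⟩, rfl⟩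
        refine ⟨g c, ⟨c, hc, rfl⟩, g.linearIsometryEquiv b, by simpa using hb, ?_⟩
        simp [hg c, add_assoc]
    rw [himg, measureReal_def, measure_vadd, measureReal_def]
    congr 1
    have := g.linearIsometryEquiv.symm.measurePreserving.measure_preimage_equiv
      (f := g.linearIsometryEquiv.symm.toHomeomorph.toMeasurableEquiv)
      (C + closedBall (0 : V) ρ)
    rw [← this]
    congr 1
    exact g.linearIsometryEquiv.toEquiv.image_eq_preimage_symm _
  have hiff : ∀ p, IsSteinerPolynomial (g '' C) p ↔ IsSteinerPolynomial C p := by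
    intro p
    simp only [IsSteinerPolynomial, hvol]
  have hiff' : IsSteinerPolynomial (g '' C) = IsSteinerPolynomial C := funext fun p => propext (hiff p)
  unfold intrinsicVolume
  rw [hiff']

variable (V) in
/-- The morphism `V_j : K_𝒫(V) → ℝ` induced by the `j`-th intrinsic volume. -/
def intrinsicVolumeHom (j : ℕ) : PolytopeGroup V →+ ℝ :=
  QuotientAddGroup.lift _ (FreeAbelianGroup.lift fun C : polytopes V => intrinsicVolume j (C : Set V))
    (by
      rw [AddSubgroup.closure_le]
      rintro _ (⟨C, hC, rfl⟩ | ⟨C, C', U, I, hU, hI, rfl⟩ | ⟨g, C, D, hD, rfl⟩)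
      · simp [AddMonoidHom.mem_ker, hC, intrinsicVolume_empty]
      · have := intrinsicVolume_union_add_inter j C.2 C'.2 (by rw [← hU]; exact U.2)
        simp [AddMonoidHom.mem_ker, hU, hI, this]
      · simp [AddMonoidHom.mem_ker, hD, intrinsicVolume_image])

theorem intrinsicVolumeHom_cls (j : ℕ) (C : polytopes V) :
    intrinsicVolumeHom V j (cls C) = intrinsicVolume j (C : Set V) := by
  simp [intrinsicVolumeHom, cls]

end IntrinsicVolumes

section Zonotopes

variable {V : Type*} [NormedAddCommGroup V] [InnerProductSpace ℝ V]

variable (V) in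
/-- The translates of parallelotopes `{∑ aᵢ vᵢ | 0 ≤ aᵢ ≤ 1}` with `v₁, …, v_r` linearly
independent, of any dimension `r ≥ 0`. -/
def parallelotopes : Set (Set V) :=
  {P | ∃ (r : ℕ) (v : Fin r → V) (a : V), LinearIndependent ℝ v ∧ P = a +ᵥ parallelepiped v}

theorem parallelotopes_subset_polytopes [FiniteDimensional ℝ V] :
    parallelotopes V ⊆ polytopes V := by
  classical
  rintro _ ⟨r, v, a, hv, rfl⟩
  let b := Module.Basis.sumExtend hv
  have hb : ∀ i, b (Sum.inl i) = v i := fun i => by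
    simp [b, Module.Basis.sumExtend, Module.Basis.reindex_apply]
    rfl
  let _ : Fintype (Module.Basis.sumExtendIndex hv) :=
    @Fintype.sumRight _ _ (FiniteDimensional.fintypeBasisIndex b)
  let u : Fin r ⊕ Module.Basis.sumExtendIndex hv → V := fun i =>
    (InnerProductSpace.toDual ℝ V).symm (LinearMap.toContinuousLinearMap (b.coord i))
  have hu : ∀ i x, inner ℝ (u i) x = b.repr x i := fun i x => by simp [u]
  let δ : Fin r ⊕ Module.Basis.sumExtendIndex hv → ℝ := Sum.elim 1 0
  have hpar : ∀ x, x ∈ parallelepiped v ↔ ∀ i, 0 ≤ b.repr x i ∧ b.repr x i ≤ δ i := by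
    intro x
    rw [mem_parallelepiped_iff]
    constructor
    · rintro ⟨t, ht, rfl⟩ i
      have : b.repr (∑ j, t j • v j) i = Sum.elim t 0 i := by
        simp only [← hb, map_sum, map_smul, Module.Basis.repr_self, Finsupp.coe_finsetSum,
          Finset.sum_apply]
        rcases i with i | i <;> simp [Finsupp.single_apply]
      rw [this]
      rcases i with i | i
      · exact ⟨ht.1 i, ht.2 i⟩
      · simp [δ]
    · intro h
      refine ⟨fun i => b.repr x (Sum.inl i), ⟨fun i => (h _).1, fun i => (h (Sum.inl i)).2⟩, ?_⟩
      have h0 : ∀ i, b.repr x (Sum.inr i) = 0 := fun i =>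
        le_antisymm (h (Sum.inr i)).2 (h (Sum.inr i)).1
      conv_lhs => rw [← b.sum_repr x]
      rw [Fintype.sum_sum_type]
      simp [h0, hb]
  refine ⟨?_, Finset.univ.image (fun i => (-u i, -b.repr a i)) ∪
    Finset.univ.image (fun i => (u i, b.repr a i + δ i)), ?_⟩
  · refine Bornology.IsBounded.vadd ?_ a
    exact (isCompact_Icc.image (by fun_prop)).isBounded
  · ext x
    rw [Set.mem_vadd_set_iff_neg_vadd_mem, hpar]
    simp only [Set.mem_iInter, mem_halfSpace, Finset.mem_union, Finset.mem_image,
      Finset.mem_univ, true_and, or_imp, forall_and, forall_exists_index,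
      forall_apply_eq_imp_iff, inner_neg_left, hu, neg_le_neg_iff, vadd_eq_add, map_add, map_neg,
      Finsupp.add_apply, Finsupp.neg_apply]
    refine and_congr (forall_congr' fun i => ?_) (forall_congr' fun i => ?_)
    · constructor <;> intro h <;> linarith
    · constructor <;> intro h <;> linarith

variable (V) in
/-- The subgroup `K_𝒵(V)` of `K_𝒫(V)` generated by the classes of translated parallelotopes. -/
def parallelotopeSubgroup : AddSubgroup (PolytopeGroup V) :=
  AddSubgroup.closure {x | ∃ P : polytopes V, (P : Set V) ∈ parallelotopes V ∧ x = cls P}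

variable (V) in
/-- The family `𝒵_ext(V)` of the members of the relative Boolean algebra generated by the polytopes
whose class is in `K_𝒵(V)`. -/
def parallelotopesExt : Set (Set V) :=
  {S | RelBool (polytopes V) S ∧ extClass S ∈ parallelotopeSubgroup V}

end Zonotopes

end Dissection

end

/-! The proof replaces parallelotopes by half-open parallelotopes `{∑ aᵢ vᵢ | 0 ≤ aᵢ < 1}`. Closed
and half-open ones differ by parallelotopes of lower dimension, so by induction on the dimension the
half-open classes `boxClass v` also generate `K_𝒵(V)`. They tile exactly, without corrections from
common faces: cutting an edge gives additivity in its length (`boxClass_smul_add`), and a shear does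
not change the class (`boxClass_shear`).

Upper bound. Shears carry out Gram–Schmidt, so the edges may be taken orthogonal; an isometry aligns
them with the first `r` vectors of a fixed orthonormal basis. Products of shears also multiply one
edge by `t` and another by `t⁻¹`, so for `r > 0` only the product of the lengths matters, and the
class depends additively on it. The point contributes a copy of `ℤ` and each dimension from `1` to
`n` a copy of `ℝ`; together they give a surjection `Ψ : ℤ × ℝⁿ → K_𝒵(V)`.

Lower bound. Doubling a half-open `r`-box multiplies its class by `2 ^ r`, while `V_j` is
homogeneous of degree `j`; hence `V_j` kills it unless `j = r`. For a rectangular box, `V_r` is the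
product of the edge lengths, by squeezing Steiner's formula as `ρ → 0`. Thus `(V₀, …, V_n) ∘ Ψ` is
the inclusion `ℤ × ℝⁿ → ℝ × ℝⁿ`, so `Ψ` is injective and the intrinsic volumes invert it. -/

noncomputable section

namespace Dissection

open scoped Pointwise
open Module

/-! ### Cutting sets by hyperplanes, and additivity of classes -/

section Polytopal

variable {V : Type*} [NormedAddCommGroup V] [InnerProductSpace ℝ V]

/-- The indicator function of `S` is an integral combination of indicator functions of
polytopes. -/
def IsPolytopal (S : Set V) : Prop := ∃ x, indicatorHom V x = S.indicator 1

theorem isPolytopal_of_mem {C : Set V} (hC : C ∈ polytopes V) : IsPolytopal C :=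
  ⟨FreeAbelianGroup.of ⟨C, hC⟩, by simp [indicatorHom]⟩

/-- By Groemer's theorem, in the form `extClass_eq`, a class depends only on the indicator function.
All later cutting arguments thus reduce to a pointwise check of indicators. -/
theorem extClass_eq_sum {ι : Type*} (s : Finset ι) {S : Set V} {T : ι → Set V}
    (hT : ∀ i ∈ s, IsPolytopal (T i))
    (h : S.indicator (1 : V → ℤ) = ∑ i ∈ s, (T i).indicator 1) :
    extClass S = ∑ i ∈ s, extClass (T i) := by
  choose! x hx using hT
  have hS : indicatorHom V (∑ i ∈ s, x i) = S.indicator 1 := by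
    rw [map_sum, h]
    exact Finset.sum_congr rfl hx
  rw [extClass_eq hS, ← QuotientAddGroup.mk'_apply, map_sum]
  exact Finset.sum_congr rfl fun i hi => (extClass_eq (hx i hi)).symm

/-- One formula for three operations on formal sums: intersecting with a half-space (`c` its
indicator, `g = id`), pulling back along an isometry, and scaling (`c = 1` in both). -/
theorem indicatorHom_map (F : polytopes V → polytopes V) (c : V → ℤ) (g : V → V)
    (h : ∀ C v, (F C : Set V).indicator (1 : V → ℤ) v = c v * (C : Set V).indicator 1 (g v))
    (x : FreeAbelianGroup (polytopes V)) (v : V) :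
    indicatorHom V (FreeAbelianGroup.map F x) v = c v * indicatorHom V x (g v) := by
  induction x using FreeAbelianGroup.induction_on with
  | zero => simp
  | of C => simpa [indicatorHom, FreeAbelianGroup.map_of_apply] using h C v
  | neg C h => rw [map_neg, map_neg, map_neg, Pi.neg_apply, Pi.neg_apply, h, mul_neg]
  | add x y hx hy =>
    rw [map_add, map_add, map_add, Pi.add_apply, Pi.add_apply, hx, hy, mul_add]

theorem IsPolytopal.inter_halfSpace {S : Set V} (hS : IsPolytopal S) (a : V) (b : ℝ) :
    IsPolytopal (S ∩ halfSpace a b) := by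
  obtain ⟨x, hx⟩ := hS
  refine ⟨FreeAbelianGroup.map (fun C => ⟨_, polytope_inter_halfSpace C.2 a b⟩) x, ?_⟩
  ext v
  rw [indicatorHom_map _ ((halfSpace a b).indicator 1) id, hx]
  · by_cases h1 : v ∈ S <;> by_cases h2 : v ∈ halfSpace a b <;> simp [h1, h2]
  · intro C v
    by_cases h1 : v ∈ (C : Set V) <;> by_cases h2 : v ∈ halfSpace a b <;> simp [h1, h2]

theorem IsPolytopal.diff {S T : Set V} (hS : IsPolytopal S) (hT : IsPolytopal T) (h : T ⊆ S) :
    IsPolytopal (S \ T) := by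
  obtain ⟨x, hx⟩ := hS
  obtain ⟨y, hy⟩ := hT
  exact ⟨x - y, by rw [map_sub, hx, hy, Set.indicator_sdiff h]⟩

variable [FiniteDimensional ℝ V]

theorem setOf_le_eq_halfSpace (ℓ : V →ₗ[ℝ] ℝ) (b : ℝ) :
    {x | ℓ x ≤ b} =
      halfSpace ((InnerProductSpace.toDual ℝ V).symm (LinearMap.toContinuousLinearMap ℓ)) b := by
  ext x
  simp [mem_halfSpace]

theorem IsPolytopal.inter_le {S : Set V} (hS : IsPolytopal S) (ℓ : V →ₗ[ℝ] ℝ) (b : ℝ) :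
    IsPolytopal (S ∩ {x | ℓ x ≤ b}) := by
  rw [setOf_le_eq_halfSpace]
  exact hS.inter_halfSpace _ _

theorem IsPolytopal.inter_ge {S : Set V} (hS : IsPolytopal S) (ℓ : V →ₗ[ℝ] ℝ) (b : ℝ) :
    IsPolytopal (S ∩ {x | b ≤ ℓ x}) := by
  simpa using hS.inter_le (-ℓ) (-b)

theorem IsPolytopal.inter_lt {S : Set V} (hS : IsPolytopal S) (ℓ : V →ₗ[ℝ] ℝ) (b : ℝ) :
    IsPolytopal (S ∩ {x | ℓ x < b}) := by
  convert! hS.diff (hS.inter_ge ℓ b) Set.inter_subset_left using 1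
  ext x
  simp only [Set.mem_inter_iff, Set.mem_sdiff, Set.mem_ofPred_eq]
  rw [← not_le]
  tauto

theorem extClass_split {S : Set V} (hS : IsPolytopal S) (ℓ : V →ₗ[ℝ] ℝ) (b : ℝ) :
    extClass S = extClass (S ∩ {x | ℓ x < b}) + extClass (S ∩ {x | b ≤ ℓ x}) := by
  have := extClass_eq_sum (Finset.univ : Finset Bool) (S := S)
    (T := fun i => if i then S ∩ {x | ℓ x < b} else S ∩ {x | b ≤ ℓ x}) ?_ ?_
  · simpa using this
  · rintro (_ | _) -
    · simpa using hS.inter_ge ℓ b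
    · simpa using hS.inter_lt ℓ b
  · ext x
    by_cases h1 : x ∈ S
    · rcases lt_or_ge (ℓ x) b with h | h
      · simp [h1, h, h.not_ge]
      · simp [h1, h, h.not_gt]
    · simp [h1]

/-- Cutting a set into slabs of width one. -/
theorem extClass_slabs {S : Set V} (hS : IsPolytopal S) (ℓ : V →ₗ[ℝ] ℝ) (N : ℤ)
    (hN : ∀ x ∈ S, |ℓ x| ≤ N) :
    extClass S = ∑ k ∈ Finset.Icc (-N) N, extClass (S ∩ {x | k ≤ ℓ x} ∩ {x | ℓ x < k + 1}) := by
  refine extClass_eq_sum _ (fun k _ => (hS.inter_ge _ _).inter_lt _ _) ?_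
  ext x
  rw [Finset.sum_apply]
  by_cases h1 : x ∈ S
  · have h2 := abs_le.1 (hN x h1)
    -- The only slab containing `x` is the one indexed by the integer part of `ℓ x`.
    rw [Finset.sum_eq_single_of_mem ⌊ℓ x⌋]
    · simp [h1, Int.floor_le, Int.lt_floor_add_one]
    · rw [Finset.mem_Icc]
      exact ⟨Int.le_floor.2 (by push_cast; exact h2.1), Int.floor_le_iff.2 (by linarith)⟩
    · intro k _ hk
      refine Set.indicator_of_notMem (fun hx => hk ?_) _
      exact (Int.floor_eq_iff.2 ⟨hx.1.2, hx.2⟩).symm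
  · simp [h1]

end Polytopal

/-! ### Invariance of classes under isometries -/

section Motions

variable {V : Type*} [NormedAddCommGroup V] [InnerProductSpace ℝ V]

theorem polytope_preimage {f : V → V}
    (hf : ∀ h : V × ℝ, ∃ h' : V × ℝ, f ⁻¹' halfSpace h.1 h.2 = halfSpace h'.1 h'.2)
    {C : Set V} (hC : C ∈ polytopes V) (hb : Bornology.IsBounded (f ⁻¹' C)) :
    f ⁻¹' C ∈ polytopes V := by
  classical
  obtain ⟨-, s, rfl⟩ := hC
  choose g hg using hf
  refine ⟨hb, s.image g, ?_⟩
  rw [Finset.set_biInter_finset_image]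
  simp only [Set.preimage_iInter, hg]

theorem isometry_preimage_mem (g : V ≃ᵃⁱ[ℝ] V) {C : Set V} (hC : C ∈ polytopes V) :
    g ⁻¹' C ∈ polytopes V := by
  refine polytope_preimage (fun h => ?_) hC ?_
  · refine ⟨(g.linearIsometryEquiv.symm h.1, h.2 - inner ℝ h.1 (g 0)), ?_⟩
    ext x
    have hx : g x = g.linearIsometryEquiv x + g 0 := by simpa using g.map_vadd 0 x
    rw [Set.mem_preimage, mem_halfSpace, mem_halfSpace, hx, inner_add_right,
      ← g.linearIsometryEquiv.symm.inner_map_map h.1, g.linearIsometryEquiv.symm_apply_apply,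
      le_sub_iff_add_le]
  · exact g.isometry.antilipschitz.isBounded_preimage hC.1

theorem mk_map_isometry_preimage (g : V ≃ᵃⁱ[ℝ] V) (x : FreeAbelianGroup (polytopes V)) :
    (QuotientAddGroup.mk (FreeAbelianGroup.map
      (fun C : polytopes V => (⟨_, isometry_preimage_mem g C.2⟩ : polytopes V)) x) :
        PolytopeGroup V) = QuotientAddGroup.mk x := by
  induction x using FreeAbelianGroup.induction_on with
  | zero => simp
  | of C =>
    have hC : (C : Set V) = g '' (g ⁻¹' (C : Set V)) := (Set.image_preimage_eq _ g.surjective).symm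
    have h := (QuotientAddGroup.eq_zero_iff _).2 (AddSubgroup.subset_closure
      (Or.inr (Or.inr ⟨g, ⟨_, isometry_preimage_mem g C.2⟩, C, hC, rfl⟩)) :
        _ ∈ AddSubgroup.closure (dissectionRelations (polytopes V)))
    rw [QuotientAddGroup.mk_sub, sub_eq_zero] at h
    rw [FreeAbelianGroup.map_of_apply]
    exact h.symm
  | neg C h => rw [map_neg, QuotientAddGroup.mk_neg, QuotientAddGroup.mk_neg, h]
  | add x y hx hy => rw [map_add, QuotientAddGroup.mk_add, QuotientAddGroup.mk_add, hx, hy]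

/-- Preimages are used rather than images because indicators pull back by composition: a formal sum
representing `S` becomes one representing `g ⁻¹' S` term by term, each term keeping its class. -/
theorem extClass_preimage (g : V ≃ᵃⁱ[ℝ] V) {S : Set V} (hS : IsPolytopal S) :
    extClass (g ⁻¹' S) = extClass S := by
  obtain ⟨x, hx⟩ := hS
  rw [extClass_eq hx, ← mk_map_isometry_preimage g x]
  refine extClass_eq ?_
  ext v
  rw [indicatorHom_map _ 1 g, hx]
  · by_cases h1 : g v ∈ S <;> simp [h1]
  · intro C v
    by_cases h1 : g v ∈ (C : Set V) <;> simp [h1]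

theorem extClass_image (g : V ≃ᵃⁱ[ℝ] V) {S : Set V} (hS : IsPolytopal S) :
    extClass (g '' S) = extClass S := by
  rw [← extClass_preimage g.symm hS]
  congr 1
  exact g.toEquiv.image_eq_preimage_symm S

theorem extClass_vadd (a : V) {S : Set V} (hS : IsPolytopal S) :
    extClass (a +ᵥ S) = extClass S :=
  extClass_image (AffineIsometryEquiv.constVAdd ℝ V a) hS

end Motions

/-! ### Homogeneity of the intrinsic volumes -/

section Scaling

open MeasureTheory Metric

variable {V : Type*} [NormedAddCommGroup V] [InnerProductSpace ℝ V]

theorem smul_mem_polytopes {t : ℝ} (ht : 0 < t) {C : Set V} (hC : C ∈ polytopes V) :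
    t • C ∈ polytopes V := by
  rw [← Set.preimage_smul_inv₀ ht.ne']
  refine polytope_preimage (fun h => ⟨(h.1, t * h.2), ?_⟩) hC ?_
  · ext x
    simp only [Set.mem_preimage, mem_halfSpace, inner_smul_right]
    rw [inv_mul_le_iff₀ ht]
  · rw [Set.preimage_smul_inv₀ ht.ne']
    exact hC.1.smul₀ t

variable [FiniteDimensional ℝ V] [MeasurableSpace V] [BorelSpace V]

/-- Since `t C + ρ B = t (C + (ρ/t) B)`, the Steiner polynomial of `t C` is `tⁿ p(ρ/t)`, whose
coefficient of degree `n - j` gains the factor `tⁿ t^{-(n-j)} = tʲ`. -/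
theorem intrinsicVolume_smul {t : ℝ} (ht : 0 < t) {j : ℕ} (hj : j ≤ finrank ℝ V) {C : Set V}
    (hC : C ∈ polytopes V) : intrinsicVolume j (t • C) = t ^ j * intrinsicVolume j C := by
  obtain ⟨p, -, hp⟩ := exists_isSteinerPolynomial hC
  have hq : IsSteinerPolynomial (t • C)
      (Polynomial.C (t ^ finrank ℝ V) * p.comp (Polynomial.C t⁻¹ * Polynomial.X)) := by
    intro ρ hρ
    have hball : closedBall (0 : V) ρ = t • closedBall (0 : V) (t⁻¹ * ρ) := by
      rw [smul_closedBall' ht.ne', smul_zero, Real.norm_of_nonneg ht.le,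
        mul_inv_cancel_left₀ ht.ne']
    rw [hball, ← smul_add, measureReal_def, Measure.addHaar_smul, ENNReal.toReal_mul,
      ENNReal.toReal_ofReal (abs_nonneg _), abs_of_pos (pow_pos ht _), ← measureReal_def,
      hp _ (by positivity)]
    simp
  rw [hp.intrinsicVolume_eq, hq.intrinsicVolume_eq, Polynomial.coeff_C_mul,
    Polynomial.comp_C_mul_X_coeff, mul_div_assoc', ← mul_assoc]
  congr 1
  -- This is where `j ≤ n` matters: the subtraction is truncated.
  have : t ^ finrank ℝ V = t ^ j * t ^ (finrank ℝ V - j) := by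
    rw [← pow_add, Nat.add_sub_cancel' hj]
  rw [this, inv_pow]
  field_simp

theorem intrinsicVolumeHom_extClass_smul {t : ℝ} (ht : 0 < t) {j : ℕ} (hj : j ≤ finrank ℝ V)
    {S : Set V} (hS : IsPolytopal S) :
    intrinsicVolumeHom V j (extClass (t • S)) = t ^ j * intrinsicVolumeHom V j (extClass S) := by
  obtain ⟨x, hx⟩ := hS
  let F : polytopes V → polytopes V := fun C => ⟨_, smul_mem_polytopes ht C.2⟩
  have h1 : indicatorHom V (FreeAbelianGroup.map F x) = (t • S).indicator 1 := by
    ext v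
    rw [indicatorHom_map F 1 (fun v => t⁻¹ • v), hx]
    · by_cases h1 : t⁻¹ • v ∈ S <;> simp [h1, Set.mem_smul_set_iff_inv_smul_mem₀ ht.ne']
    · intro C v
      by_cases h1 : t⁻¹ • v ∈ (C : Set V) <;>
        simp [F, h1, Set.mem_smul_set_iff_inv_smul_mem₀ ht.ne']
  rw [extClass_eq h1, extClass_eq hx]
  clear h1 hx
  induction x using FreeAbelianGroup.induction_on with
  | zero => simp
  | of C =>
    rw [FreeAbelianGroup.map_of_apply]
    exact (intrinsicVolumeHom_cls j _).trans ((intrinsicVolume_smul ht hj C.2).trans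
      (congrArg _ (intrinsicVolumeHom_cls j C).symm))
  | neg C h =>
    rw [map_neg, QuotientAddGroup.mk_neg, QuotientAddGroup.mk_neg, map_neg, map_neg, h, mul_neg]
  | add x y hx hy =>
    rw [map_add, QuotientAddGroup.mk_add, QuotientAddGroup.mk_add, map_add, map_add, hx, hy,
      mul_add]

end Scaling

/-! ### Half-open parallelotopes: generation of `K_𝒵(V)` and additivity along an edge -/

section Boxes

variable {V : Type*} [NormedAddCommGroup V] [InnerProductSpace ℝ V] {r : ℕ}

/-- The parallelotope spanned by `v`, without the facets opposite to the origin in the directions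
selected by `p`. -/
def partialBox (v : Fin r → V) (p : Fin r → Prop) : Set V :=
  {x | ∃ a : Fin r → ℝ, (∀ i, 0 ≤ a i ∧ a i ≤ 1 ∧ (p i → a i < 1)) ∧ ∑ i, a i • v i = x}

/-- The class of the half-open parallelotope `{∑ aᵢ vᵢ | 0 ≤ aᵢ < 1}`. -/
def boxClass (v : Fin r → V) : PolytopeGroup V := extClass (partialBox v fun _ => True)

/-- The functionals `ℓ` compute the coefficients of linear combinations of `v`. -/
def IsDual (ℓ : Fin r → V →ₗ[ℝ] ℝ) (v : Fin r → V) : Prop :=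
  ∀ (a : Fin r → ℝ) (k : Fin r), ℓ k (∑ i, a i • v i) = a k

/-- The functionals are the components of a linear left inverse of `a ↦ ∑ aᵢ vᵢ`. Being defined on
all of `V`, they can serve to cut by hyperplanes even when `v` does not span. -/
theorem exists_isDual {v : Fin r → V} (hv : LinearIndependent ℝ v) : ∃ ℓ, IsDual ℓ v := by
  obtain ⟨g, hg⟩ := LinearMap.exists_leftInverse_of_injective (Fintype.linearCombination ℝ v)
    (LinearMap.ker_eq_bot.2 (by
      rw [linearIndependent_iff_injective_fintypeLinearCombination] at hv
      exact hv))
  refine ⟨fun k => LinearMap.proj k ∘ₗ g, fun a k => ?_⟩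
  have := LinearMap.congr_fun hg a
  rw [LinearMap.comp_apply, Fintype.linearCombination_apply] at this
  rw [LinearMap.comp_apply, this]
  rfl

theorem IsDual.linearIndependent {ℓ : Fin r → V →ₗ[ℝ] ℝ} {v : Fin r → V} (h : IsDual ℓ v) :
    LinearIndependent ℝ v := by
  rw [Fintype.linearIndependent_iff]
  intro a ha i
  rw [← h a i, ha, map_zero]

/-- The equation `∑ ℓ k x • v k = x` says that `x` lies in the span of `v`; the rest are linear
inequalities. -/
theorem IsDual.mem_partialBox {ℓ : Fin r → V →ₗ[ℝ] ℝ} {v : Fin r → V} (h : IsDual ℓ v)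
    (p : Fin r → Prop) (x : V) : x ∈ partialBox v p ↔
      ∑ k, ℓ k x • v k = x ∧ ∀ i, 0 ≤ ℓ i x ∧ ℓ i x ≤ 1 ∧ (p i → ℓ i x < 1) := by
  constructor
  · rintro ⟨a, ha, rfl⟩
    simp only [h a]
    exact ⟨trivial, ha⟩
  · rintro ⟨h1, h2⟩
    exact ⟨_, h2, h1⟩

theorem IsDual.mem_box {ℓ : Fin r → V →ₗ[ℝ] ℝ} {v : Fin r → V} (h : IsDual ℓ v) (x : V) :
    x ∈ partialBox v (fun _ => True) ↔
      ∑ k, ℓ k x • v k = x ∧ ∀ i, 0 ≤ ℓ i x ∧ ℓ i x < 1 := by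
  rw [h.mem_partialBox]
  refine and_congr_right fun _ => forall_congr' fun i => ?_
  constructor
  · rintro ⟨h1, -, h2⟩
    exact ⟨h1, h2 trivial⟩
  · rintro ⟨h1, h2⟩
    exact ⟨h1, h2.le, fun _ => h2⟩

theorem IsDual.smul {ℓ : Fin r → V →ₗ[ℝ] ℝ} {v : Fin r → V} (h : IsDual ℓ v) {c : Fin r → ℝ}
    (hc : ∀ i, c i ≠ 0) : IsDual (fun i => (c i)⁻¹ • ℓ i) (fun i => c i • v i) := by
  intro a k
  simp only [smul_smul, LinearMap.smul_apply]
  rw [h fun i => a i * c i]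
  have := hc k
  simp only [smul_eq_mul]
  field_simp

theorem linearIndependent_smul {v : Fin r → V} (hv : LinearIndependent ℝ v) {c : Fin r → ℝ}
    (hc : ∀ i, c i ≠ 0) : LinearIndependent ℝ fun i => c i • v i := by
  obtain ⟨ℓ, hℓ⟩ := exists_isDual hv
  exact (hℓ.smul hc).linearIndependent

theorem IsDual.mem_box_smul {ℓ : Fin r → V →ₗ[ℝ] ℝ} {v : Fin r → V} (h : IsDual ℓ v)
    {c : Fin r → ℝ} (hc : ∀ i, 0 < c i) (x : V) :
    x ∈ partialBox (fun i => c i • v i) (fun _ => True) ↔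
      ∑ k, ℓ k x • v k = x ∧ ∀ i, 0 ≤ ℓ i x ∧ ℓ i x < c i := by
  rw [(h.smul fun i => (hc i).ne').mem_box]
  refine and_congr ?_ (forall_congr' fun i => and_congr ?_ ?_)
  · refine Eq.congr_left (Finset.sum_congr rfl fun i _ => ?_)
    rw [LinearMap.smul_apply, smul_eq_mul, smul_smul, mul_right_comm,
      inv_mul_cancel₀ (hc i).ne', one_mul]
  · rw [LinearMap.smul_apply, smul_eq_mul, mul_nonneg_iff_of_pos_left (inv_pos.2 (hc i))]
  · rw [LinearMap.smul_apply, smul_eq_mul, inv_mul_lt_iff₀ (hc i), mul_one]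

theorem IsDual.partialBox_inter_lt {ℓ : Fin r → V →ₗ[ℝ] ℝ} {v : Fin r → V} (h : IsDual ℓ v)
    (p : Fin r → Prop) (i : Fin r) :
    partialBox v p ∩ {x | ℓ i x < 1} = partialBox v (fun k => k = i ∨ p k) := by
  ext x
  rw [Set.mem_inter_iff, h.mem_partialBox, h.mem_partialBox, and_assoc]
  refine and_congr_right fun _ => ?_
  constructor
  · rintro ⟨h1, h2⟩ k
    refine ⟨(h1 k).1, (h1 k).2.1, ?_⟩
    rintro (rfl | hk)
    · exact h2
    · exact (h1 k).2.2 hk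
  · intro h1
    exact ⟨fun k => ⟨(h1 k).1, (h1 k).2.1, fun hk => (h1 k).2.2 (Or.inr hk)⟩,
      (h1 i).2.2 (Or.inl rfl)⟩

/-- The facet `aᵢ = 1` is a translate of the box on the remaining edges; this drives the inductions
on the dimension. -/
theorem IsDual.partialBox_inter_ge {ℓ : Fin (r + 1) → V →ₗ[ℝ] ℝ} {v : Fin (r + 1) → V}
    (h : IsDual ℓ v) (p : Fin (r + 1) → Prop) (i : Fin (r + 1)) (hi : ¬ p i) :
    partialBox v p ∩ {x | 1 ≤ ℓ i x} =
      v i +ᵥ partialBox (v ∘ i.succAbove) (p ∘ i.succAbove) := by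
  ext x
  rw [Set.mem_vadd_set]
  constructor
  · rintro ⟨⟨a, ha, rfl⟩, h1⟩
    have h1 : 1 ≤ ℓ i (∑ k, a k • v k) := h1
    rw [h a] at h1
    have hai : a i = 1 := le_antisymm (ha i).2.1 h1
    refine ⟨_, ⟨a ∘ i.succAbove, fun k => ha _, rfl⟩, ?_⟩
    rw [Fin.sum_univ_succAbove _ i, hai, one_smul]
    rfl
  · rintro ⟨_, ⟨a, ha, rfl⟩, rfl⟩
    have e : v i +ᵥ ∑ k, a k • (v ∘ i.succAbove) k =
        ∑ k, (i.insertNth (α := fun _ => ℝ) 1 a) k • v k := by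
      rw [Fin.sum_univ_succAbove _ i]
      simp
    rw [e]
    refine ⟨⟨_, fun k => ?_, rfl⟩, ?_⟩
    · rcases Fin.eq_self_or_eq_succAbove i k with rfl | ⟨k, rfl⟩
      · simp [hi]
      · simpa using ha k
    · rw [Set.mem_ofPred_eq, h, Fin.insertNth_apply_same]

theorem partialBox_false (v : Fin r → V) :
    partialBox v (fun _ => False) = parallelepiped v := by
  ext x
  rw [mem_parallelepiped_iff]
  constructor
  · rintro ⟨a, ha, rfl⟩
    exact ⟨a, ⟨fun i => (ha i).1, fun i => (ha i).2.1⟩, rfl⟩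
  · rintro ⟨a, ha, rfl⟩
    exact ⟨a, fun i => ⟨ha.1 i, ha.2 i, False.elim⟩, rfl⟩

theorem smul_partialBox (t : ℝ) (v : Fin r → V) (p : Fin r → Prop) :
    t • partialBox v p = partialBox (fun i => t • v i) p := by
  have e : ∀ a : Fin r → ℝ, ∑ i, a i • t • v i = t • ∑ i, a i • v i := fun a => by
    rw [Finset.smul_sum]
    exact Finset.sum_congr rfl fun i _ => smul_comm _ _ _
  ext x
  constructor
  · rintro ⟨_, ⟨a, ha, rfl⟩, rfl⟩
    exact ⟨a, ha, e a⟩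
  · rintro ⟨a, ha, rfl⟩
    exact ⟨_, ⟨a, ha, rfl⟩, (e a).symm⟩

theorem image_partialBox (g : V ≃ₗᵢ[ℝ] V) (v : Fin r → V) (p : Fin r → Prop) :
    g '' partialBox v p = partialBox (g ∘ v) p := by
  have e : ∀ a : Fin r → ℝ, ∑ i, a i • (g ∘ v) i = g (∑ i, a i • v i) := fun a => by
    simp
  ext x
  constructor
  · rintro ⟨_, ⟨a, ha, rfl⟩, rfl⟩
    exact ⟨a, ha, e a⟩
  · rintro ⟨a, ha, rfl⟩
    exact ⟨_, ⟨a, ha, rfl⟩, (e a).symm⟩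

variable [FiniteDimensional ℝ V]

theorem parallelepiped_mem_polytopes {v : Fin r → V} (hv : LinearIndependent ℝ v) :
    parallelepiped v ∈ polytopes V :=
  parallelotopes_subset_polytopes ⟨r, v, 0, hv, by simp⟩

theorem isPolytopal_partialBox {v : Fin r → V} (hv : LinearIndependent ℝ v) (p : Fin r → Prop) :
    IsPolytopal (partialBox v p) := by
  classical
  obtain ⟨ℓ, hℓ⟩ := exists_isDual hv
  have key : ∀ s : Finset (Fin r), IsPolytopal (partialBox v (· ∈ s)) := by
    intro s
    induction s using Finset.induction_on with
    | empty =>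
      simp only [Finset.notMem_empty, partialBox_false]
      exact isPolytopal_of_mem (parallelepiped_mem_polytopes hv)
    | insert i s _ ih =>
      simp only [Finset.mem_insert]
      rw [← hℓ.partialBox_inter_lt]
      exact ih.inter_lt _ _
  simpa using key (Finset.univ.filter p)

theorem extClass_partialBox_facet {v : Fin (r + 1) → V} (hv : LinearIndependent ℝ v)
    (p : Fin (r + 1) → Prop) (i : Fin (r + 1)) (hi : ¬ p i) :
    extClass (partialBox v p) = extClass (partialBox v fun k => k = i ∨ p k) +
      extClass (partialBox (v ∘ i.succAbove) (p ∘ i.succAbove)) := by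
  obtain ⟨ℓ, hℓ⟩ := exists_isDual hv
  rw [extClass_split (isPolytopal_partialBox hv p) (ℓ i) 1, hℓ.partialBox_inter_lt,
    hℓ.partialBox_inter_ge p i hi, extClass_vadd]
  exact isPolytopal_partialBox (hv.comp _ i.succAbove_right_injective) _

/-- Modulo the classes of lower-dimensional parallelotopes, the class of a parallelotope does not
depend on which facets are removed. -/
theorem extClass_partialBox_sub_mem (H : AddSubgroup (PolytopeGroup V)) {N : ℕ}
    (hlow : ∀ r < N, ∀ v : Fin r → V, LinearIndependent ℝ v → ∀ p,
      extClass (partialBox v p) ∈ H)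
    {v : Fin N → V} (hv : LinearIndependent ℝ v) (p q : Fin N → Prop) :
    extClass (partialBox v p) - extClass (partialBox v q) ∈ H := by
  classical
  rcases N with _ | r
  · rw [Subsingleton.elim p q, sub_self]
    exact zero_mem _
  -- Starting from the closed box, the facets in `s` are removed one at a time; each removal changes
  -- the class by that of an `r`-dimensional box, which lies in `H`.
  have key : ∀ s : Finset (Fin (r + 1)), extClass (partialBox v fun _ => False) -
      extClass (partialBox v (· ∈ s)) ∈ H := by
    intro s
    induction s using Finset.induction_on with
    | empty => simp
    | insert i s hi ih =>
      have h1 := extClass_partialBox_facet hv (· ∈ s) i hi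
      have h2 := hlow r (Nat.lt_succ_self r) _ (hv.comp _ i.succAbove_right_injective)
        ((· ∈ s) ∘ i.succAbove)
      simp only [Finset.mem_insert]
      have h3 := add_mem ih h2
      rw [h1] at h3
      convert! h3 using 1
      abel
  have hp := key (Finset.univ.filter p)
  have hq := key (Finset.univ.filter q)
  simp only [Finset.mem_filter, Finset.mem_univ, true_and] at hp hq
  simpa using sub_mem hq hp

/-- If one kind of box in each dimension below `N` has its class in `H`, then all kinds do. Taking
`q` constantly false or constantly true shows that closed and half-open boxes generate the same
subgroup; taking for `H` the kernel of `V_j` transfers vanishing statements. -/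
theorem extClass_partialBox_mem (H : AddSubgroup (PolytopeGroup V)) (q : ∀ r, Fin r → Prop)
    (N : ℕ) (hH : ∀ r < N, ∀ v : Fin r → V, LinearIndependent ℝ v →
      extClass (partialBox v (q r)) ∈ H) :
    ∀ r < N, ∀ v : Fin r → V, LinearIndependent ℝ v → ∀ p, extClass (partialBox v p) ∈ H := by
  intro r
  induction r using Nat.strong_induction_on with
  | _ r ih =>
    intro hr v hv p
    have := extClass_partialBox_sub_mem H (fun k hk => ih k hk (hk.trans hr)) hv p (q r)
    simpa using add_mem this (hH r hr v hv)

theorem boxClass_mem_parallelotopeSubgroup {v : Fin r → V} (hv : LinearIndependent ℝ v) :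
    boxClass v ∈ parallelotopeSubgroup V := by
  refine extClass_partialBox_mem _ (fun _ _ => False) (r + 1) ?_ r (Nat.lt_succ_self r) v hv _
  intro k _ w hw
  rw [partialBox_false]
  refine AddSubgroup.subset_closure ⟨⟨_, parallelepiped_mem_polytopes hw⟩, ?_, ?_⟩
  · exact ⟨k, w, 0, hw, by simp⟩
  · exact extClass_polytope ⟨_, parallelepiped_mem_polytopes hw⟩

theorem parallelotopeSubgroup_le (H : AddSubgroup (PolytopeGroup V))
    (hH : ∀ (r : ℕ) (v : Fin r → V), LinearIndependent ℝ v → boxClass v ∈ H) :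
    parallelotopeSubgroup V ≤ H := by
  refine (AddSubgroup.closure_le _).2 ?_
  rintro _ ⟨P, ⟨r, v, a, hv, hP⟩, rfl⟩
  rw [← extClass_polytope, hP, extClass_vadd _ (isPolytopal_of_mem
    (parallelepiped_mem_polytopes hv)), ← partialBox_false]
  exact extClass_partialBox_mem H (fun _ _ => True) (r + 1) (fun k _ w hw => hH k w hw) r
    (Nat.lt_succ_self r) v hv _

theorem boxClass_isometry (g : V ≃ₗᵢ[ℝ] V) {v : Fin r → V} (hv : LinearIndependent ℝ v) :
    boxClass (g ∘ v) = boxClass v := by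
  rw [boxClass, ← image_partialBox]
  exact extClass_image g.toAffineIsometryEquiv (isPolytopal_partialBox hv _)

/-- The hyperplane `ℓ i = a` cuts the box of edge length `a + b` into the box of edge length `a` and
the translate by `a • v i` of the one of edge length `b`. Half-openness makes the union disjoint. -/
theorem boxClass_smul_add {v : Fin r → V} (hv : LinearIndependent ℝ v) {c : Fin r → ℝ}
    (hc : ∀ i, 0 < c i) (i : Fin r) {a b : ℝ} (ha : 0 < a) (hb : 0 < b) :
    boxClass (fun k => Function.update c i (a + b) k • v k) =
      boxClass (fun k => Function.update c i a k • v k) +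
        boxClass (fun k => Function.update c i b k • v k) := by
  obtain ⟨ℓ, hℓ⟩ := exists_isDual hv
  have hpos : ∀ {s : ℝ}, 0 < s → ∀ k, 0 < Function.update c i s k := fun {s} hs k => by
    rcases eq_or_ne k i with rfl | hk
    · simpa using hs
    · simpa [hk] using hc k
  have hpol : ∀ {s : ℝ}, 0 < s → IsPolytopal (partialBox
      (fun k => Function.update c i s k • v k) fun _ => True) := fun hs =>
    isPolytopal_partialBox (linearIndependent_smul hv fun k => (hpos hs k).ne') _
  unfold boxClass
  rw [extClass_split (hpol (add_pos ha hb)) (ℓ i) a, ← extClass_vadd (a • v i) (hpol hb)]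
  have hi : ∀ k, ℓ k (v i) = if k = i then 1 else 0 := fun k => by
    have := hℓ (Pi.single i 1) k
    simpa [Pi.single_apply] using this
  have hrep : ∑ k, ℓ k (v i) • v k = v i := by simp [hi]
  congr 2
  · ext x
    rw [Set.mem_inter_iff, hℓ.mem_box_smul (hpos (add_pos ha hb)), hℓ.mem_box_smul (hpos ha),
      and_assoc]
    refine and_congr_right fun _ => ?_
    constructor
    · rintro ⟨h1, h2⟩ k
      rcases eq_or_ne k i with rfl | hk
      · simpa using ⟨(h1 k).1, h2⟩
      · simpa [hk] using h1 k
    · intro h1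
      have h2 := h1 i
      rw [Function.update_self] at h2
      refine ⟨fun k => ?_, h2.2⟩
      rcases eq_or_ne k i with rfl | hk
      · rw [Function.update_self]
        exact ⟨h2.1, by linarith⟩
      · simpa [hk] using h1 k
  · ext x
    rw [Set.mem_vadd_set_iff_neg_vadd_mem, Set.mem_inter_iff,
      hℓ.mem_box_smul (hpos (add_pos ha hb)), hℓ.mem_box_smul (hpos hb), and_assoc]
    have hx : ∀ k, ℓ k (-(a • v i) +ᵥ x) = ℓ k x - if k = i then a else 0 := fun k => by
      rw [vadd_eq_add, map_add, map_neg, map_smul, hi]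
      split_ifs <;> simp [sub_eq_neg_add]
    refine and_congr ?_ ?_
    · simp only [vadd_eq_add, map_add, map_neg, map_smul, add_smul, neg_smul, smul_assoc,
        Finset.sum_add_distrib, Finset.sum_neg_distrib]
      rw [← Finset.smul_sum, hrep, add_right_inj]
    · simp only [hx]
      constructor
      · rintro ⟨h1, h2⟩ k
        have h2 : a ≤ ℓ i x := h2
        have h3 := h1 k
        rcases eq_or_ne k i with rfl | hk
        · simp only [Function.update_self, if_true] at h3 ⊢
          exact ⟨by linarith, by linarith⟩
        · simpa [hk] using h3
      · intro h1
        have h2 := h1 i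
        simp only [Function.update_self, if_true] at h2
        refine ⟨fun k => ?_, ?_⟩
        · have h3 := h1 k
          rcases eq_or_ne k i with rfl | hk
          · simp only [Function.update_self]
            exact ⟨by linarith, by linarith⟩
          · simpa [hk] using h3
        · change a ≤ ℓ i x
          linarith

end Boxes

/-! ### Shears, Gram–Schmidt and reduction to standard boxes -/

section NormalForm

variable {V : Type*} [NormedAddCommGroup V] [InnerProductSpace ℝ V] [FiniteDimensional ℝ V]
  {r : ℕ}

omit [FiniteDimensional ℝ V] in
theorem sum_smul_update_add (v : Fin r → V) (i : Fin r) (z : V) (a : Fin r → ℝ) :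
    ∑ k, a k • Function.update v i (v i + z) k = ∑ k, a k • v k + a i • z := by
  have : ∀ k, a k • Function.update v i (v i + z) k =
      a k • v k + if k = i then a i • z else 0 := fun k => by
    rcases eq_or_ne k i with rfl | hk <;> simp [*]
  simp [this, Finset.sum_add_distrib]

omit [FiniteDimensional ℝ V] in
-- A combination of the sheared edges with coefficients `a` has old coordinates `a`, except that the
-- `j`-th is `a j + t * a i`; hence the correction `ℓ j - t • ℓ i`.
theorem IsDual.shear {ℓ : Fin r → V →ₗ[ℝ] ℝ} {v : Fin r → V} (h : IsDual ℓ v) {i j : Fin r}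
    (hij : i ≠ j) (t : ℝ) :
    IsDual (Function.update ℓ j (ℓ j - t • ℓ i)) (Function.update v i (v i + t • v j)) := by
  intro a k
  have e : ∑ k, a k • v k + a i • t • v j =
      ∑ k, (a + Pi.single j (a i * t) : Fin r → ℝ) k • v k := by
    simp [add_smul, Finset.sum_add_distrib, Pi.single_apply, smul_smul]
  rw [sum_smul_update_add, e]
  rcases eq_or_ne k j with rfl | hk
  · rw [Function.update_self, LinearMap.sub_apply, LinearMap.smul_apply, h, h]
    simp [hij, mul_comm]
  · rw [Function.update_of_ne hk, h]
    simp [hk]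

/-- Shearing a half-open parallelotope does not change its class: both are cut into slabs that
are translates of each other. -/
theorem boxClass_shear {v : Fin r → V} (hv : LinearIndependent ℝ v) {i j : Fin r} (hij : i ≠ j)
    (t : ℝ) : boxClass (Function.update v i (v i + t • v j)) = boxClass v := by
  obtain ⟨ℓ, hℓ⟩ := exists_isDual hv
  have hw := hℓ.shear hij t
  set w := Function.update v i (v i + t • v j) with hwdef
  have hpv := isPolytopal_partialBox hv fun _ => True
  have hpw := isPolytopal_partialBox hw.linearIndependent fun _ => True
  -- The span condition is the same for both boxes, so they differ only in the `j`-th constraint: on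
  -- `ℓ j` for `v`, on `ℓ j - t • ℓ i` for `w`.
  have hrep : ∀ x, ∑ k, Function.update ℓ j (ℓ j - t • ℓ i) k x • w k = ∑ k, ℓ k x • v k := by
    intro x
    rw [sum_smul_update_add, Function.update_of_ne hij]
    have : ∀ k, Function.update ℓ j (ℓ j - t • ℓ i) k x • v k =
        ℓ k x • v k - if k = j then (t * ℓ i x) • v j else 0 := fun k => by
      rcases eq_or_ne k j with rfl | hk <;> simp [*, sub_smul]
    simp [this, smul_smul, mul_comm]
  have hmw : ∀ x, x ∈ partialBox w (fun _ => True) ↔ ∑ k, ℓ k x • v k = x ∧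
      (∀ k, k ≠ j → 0 ≤ ℓ k x ∧ ℓ k x < 1) ∧ 0 ≤ (ℓ j - t • ℓ i) x ∧ (ℓ j - t • ℓ i) x < 1 := by
    intro x
    rw [hw.mem_box, hrep]
    refine and_congr_right fun _ => ⟨fun h => ⟨fun k hk => ?_, ?_⟩, fun h k => ?_⟩
    · simpa [hk] using h k
    · simpa using h j
    · rcases eq_or_ne k j with rfl | hk
      · simpa using h.2
      · simpa [hk] using h.1 k hk
  have hmv : ∀ x, x ∈ partialBox v (fun _ => True) ↔ ∑ k, ℓ k x • v k = x ∧
      (∀ k, k ≠ j → 0 ≤ ℓ k x ∧ ℓ k x < 1) ∧ 0 ≤ ℓ j x ∧ ℓ j x < 1 := by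
    intro x
    rw [hℓ.mem_box]
    refine and_congr_right fun _ => ⟨fun h => ⟨fun k _ => h k, h j⟩, fun h k => ?_⟩
    rcases eq_or_ne k j with rfl | hk
    · exact h.2
    · exact h.1 k hk
  -- `1 + |t|` bounds `ℓ j` on the sheared box and `ℓ j - t • ℓ i` on the original one.
  obtain ⟨N, hN⟩ := exists_int_gt (1 + |t|)
  have hb : ∀ y s : ℝ, 0 ≤ y → y < 1 → 0 ≤ s → s < 1 → |y + t * s| ≤ N ∧ |y - t * s| ≤ N := by
    intro y s hy hy1 hs hs1
    have h1 : |t * s| ≤ |t| := by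
      rw [abs_mul, abs_of_nonneg hs]
      exact mul_le_of_le_one_right (abs_nonneg t) hs1.le
    have h2 : |y| ≤ 1 := abs_le.2 ⟨by linarith, hy1.le⟩
    exact ⟨(abs_add_le _ _).trans (by linarith), (abs_sub _ _).trans (by linarith)⟩
  have hvj : ∀ k, ℓ k (v j) = if k = j then 1 else 0 := fun k => by
    have := hℓ (Pi.single j 1) k
    simpa [Pi.single_apply] using this
  have hvrep : ∑ k, ℓ k (v j) • v k = v j := by simp [hvj]
  unfold boxClass
  -- Each box is cut by the functional that constrains the other. Translation by `-k • v j` brings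
  -- `k ≤ ℓ j < k + 1` to `0 ≤ ℓ j < 1` and `0 ≤ ℓ j - t • ℓ i < 1` to the slab of index `-k`; so
  -- slab `k` of the sheared box matches slab `-k` of the original.
  rw [extClass_slabs hpw (ℓ j) N, extClass_slabs hpv (ℓ j - t • ℓ i) N]
  · refine Finset.sum_nbij' (fun k => -k) (fun k => -k) ?_ ?_ ?_ ?_ ?_
    · intro k; simp only [Finset.mem_Icc]; omega
    · intro k; simp only [Finset.mem_Icc]; omega
    · simp
    · simp
    · intro k _
      rw [← extClass_vadd ((k : ℝ) • v j) ((hpv.inter_ge _ _).inter_lt _ _)]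
      congr 1
      ext x
      rw [Set.mem_vadd_set_iff_neg_vadd_mem]
      have hx : ∀ m, ℓ m (-((k : ℝ) • v j) +ᵥ x) = ℓ m x - if m = j then (k : ℝ) else 0 :=
        fun m => by
          rw [vadd_eq_add, map_add, map_neg, map_smul, hvj]
          split_ifs <;> simp [sub_eq_neg_add]
      have hx' : ∑ m, ℓ m (-((k : ℝ) • v j) +ᵥ x) • v m = -((k : ℝ) • v j) +ᵥ x ↔
          ∑ m, ℓ m x • v m = x := by
        simp only [vadd_eq_add, map_add, map_neg, map_smul, add_smul, neg_smul, smul_assoc,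
          Finset.sum_add_distrib, Finset.sum_neg_distrib]
        rw [← Finset.smul_sum, hvrep, add_right_inj]
      simp only [Set.mem_inter_iff, hmw, hmv, hx', Set.mem_ofPred_eq, LinearMap.sub_apply,
        LinearMap.smul_apply, smul_eq_mul]
      simp only [hx, if_neg hij, if_true, sub_zero]
      push_cast
      have hne : (∀ m, m ≠ j → 0 ≤ ℓ m x - (if m = j then (k : ℝ) else 0) ∧
          ℓ m x - (if m = j then (k : ℝ) else 0) < 1) ↔
          ∀ m, m ≠ j → 0 ≤ ℓ m x ∧ ℓ m x < 1 :=
        forall_congr' fun m => imp_congr_right fun hm => by rw [if_neg hm, sub_zero]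
      rw [hne]
      constructor
      · rintro ⟨⟨⟨h1, h2, h3, h4⟩, h5⟩, h6⟩
        exact ⟨⟨⟨h1, h2, by linarith, by linarith⟩, by linarith⟩, by linarith⟩
      · rintro ⟨⟨⟨h1, h2, h3, h4⟩, h5⟩, h6⟩
        exact ⟨⟨⟨h1, h2, by linarith, by linarith⟩, by linarith⟩, by linarith⟩
  · intro x hx
    obtain ⟨-, h2, h3, h4⟩ := (hmv x).1 hx
    exact (hb _ _ h3 h4 (h2 i hij).1 (h2 i hij).2).2
  · intro x hx
    obtain ⟨-, h2, h3, h4⟩ := (hmw x).1 hx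
    simpa using (hb _ _ h3 h4 (h2 i hij).1 (h2 i hij).2).1

/-- A succession of shears of edge `i`. As `i ∉ s`, the edges being added are never modified;
independence is carried along because each shear requires it. -/
theorem boxClass_add_sum {v : Fin r → V} (hv : LinearIndependent ℝ v) {i : Fin r}
    (s : Finset (Fin r)) (hi : i ∉ s) (c : Fin r → ℝ) :
    LinearIndependent ℝ (Function.update v i (v i + ∑ j ∈ s, c j • v j)) ∧
      boxClass (Function.update v i (v i + ∑ j ∈ s, c j • v j)) = boxClass v := by
  induction s using Finset.induction_on with
  | empty => simpa using hv
  | insert j s hj ih =>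
    rw [Finset.mem_insert, not_or] at hi
    obtain ⟨h1, h2⟩ := ih hi.2
    obtain ⟨ℓ, hℓ⟩ := exists_isDual h1
    have h3 := (hℓ.shear hi.1 (c j)).linearIndependent
    have h4 := boxClass_shear h1 hi.1 (c j)
    have e : Function.update (Function.update v i (v i + ∑ j ∈ s, c j • v j)) i
        (Function.update v i (v i + ∑ j ∈ s, c j • v j) i +
          c j • Function.update v i (v i + ∑ j ∈ s, c j • v j) j) =
        Function.update v i (v i + ∑ j ∈ insert j s, c j • v j) := by
      rw [Function.update_idem, Function.update_self, Function.update_of_ne (Ne.symm hi.1),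
        Finset.sum_insert hj, add_assoc, add_comm (c j • v j)]
    rw [e] at h3 h4
    exact ⟨h3, h4.trans h2⟩

/-- Unnormalised Gram–Schmidt only subtracts from each vector multiples of the earlier, already
orthogonalised ones. The induction is on the number `k` of vectors already treated. -/
theorem boxClass_gramSchmidt {v : Fin r → V} (hv : LinearIndependent ℝ v) :
    boxClass (InnerProductSpace.gramSchmidt ℝ v) = boxClass v := by
  have key : ∀ k ≤ r,
      LinearIndependent ℝ (fun i : Fin r =>
        if (i : ℕ) < k then InnerProductSpace.gramSchmidt ℝ v i else v i) ∧
      boxClass (fun i : Fin r =>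
        if (i : ℕ) < k then InnerProductSpace.gramSchmidt ℝ v i else v i) = boxClass v := by
    intro k
    induction k with
    | zero => intro _; simpa using hv
    | succ k ih =>
      intro hk
      obtain ⟨h1, h2⟩ := ih (Nat.le_of_succ_le hk)
      let i : Fin r := ⟨k, hk⟩
      let c : Fin r → ℝ := fun j => -(inner ℝ (InnerProductSpace.gramSchmidt ℝ v j) (v i) /
        ‖InnerProductSpace.gramSchmidt ℝ v j‖ ^ 2)
      have h3 := boxClass_add_sum h1 (i := i) (Finset.Iio i) (by simp) c
      rw [h2] at h3
      let u : Fin r → V := fun m =>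
        if (m : ℕ) < k then InnerProductSpace.gramSchmidt ℝ v m else v m
      have e : (fun m : Fin r =>
          if (m : ℕ) < k + 1 then InnerProductSpace.gramSchmidt ℝ v m else v m) =
            Function.update u i (u i + ∑ j ∈ Finset.Iio i, c j • u j) := by
        funext m
        rcases lt_trichotomy m i with hm | rfl | hm
        · have hm' : (m : ℕ) < k := hm
          simp [u, hm.ne, hm', hm'.trans (Nat.lt_succ_self k)]
        · rw [Function.update_self, if_pos (Nat.lt_succ_self k),
            show u i = v i from if_neg (lt_irrefl k), InnerProductSpace.gramSchmidt_def, sub_eq_add_neg,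
            ← Finset.sum_neg_distrib]
          congr 1
          refine Finset.sum_congr rfl fun j hj => ?_
          have hj' : (j : ℕ) < k := Fin.lt_def.1 (Finset.mem_Iio.1 hj)
          rw [show u j = _ from if_pos hj', Submodule.starProjection_singleton]
          simp [c]
        · have hm' : k < (m : ℕ) := hm
          simp [u, hm.ne', not_lt.2 (Nat.succ_le_of_lt hm'), hm'.le]
      rw [e]
      exact h3
  simpa using (key r le_rfl).2

/-- Three shears compose to this map, as with elementary matrices: `(vᵢ, vⱼ) ↦ (vᵢ + t vⱼ, vⱼ) ↦ (vᵢ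
+ t vⱼ, -t⁻¹ vᵢ) ↦ (t vⱼ, -t⁻¹ vᵢ)`. -/
theorem boxClass_swap {v : Fin r → V} (hv : LinearIndependent ℝ v) {i j : Fin r} (hij : i ≠ j)
    {t : ℝ} (ht : t ≠ 0) :
    LinearIndependent ℝ (Function.update (Function.update v i (t • v j)) j (-t⁻¹ • v i)) ∧
      boxClass (Function.update (Function.update v i (t • v j)) j (-t⁻¹ • v i)) =
        boxClass v := by
  have step : ∀ (u w : Fin r → V) (i j : Fin r) (t : ℝ), i ≠ j →
      w = Function.update u i (u i + t • u j) → LinearIndependent ℝ u →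
      LinearIndependent ℝ w ∧ boxClass w = boxClass u := by
    rintro u _ i j t hij rfl hu
    obtain ⟨ℓ, hℓ⟩ := exists_isDual hu
    exact ⟨(hℓ.shear hij t).linearIndependent, boxClass_shear hu hij t⟩
  obtain ⟨h1, e1⟩ := step v _ i j t hij rfl hv
  obtain ⟨h2, e2⟩ := step _
    (Function.update (Function.update v i (v i + t • v j)) j (-t⁻¹ • v i)) j i (-t⁻¹) hij.symm
    (by
      congr 1
      rw [Function.update_self, Function.update_of_ne hij.symm, smul_add, smul_smul, neg_mul,
        inv_mul_cancel₀ ht]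
      module) h1
  obtain ⟨h3, e3⟩ := step _
    (Function.update (Function.update v i (t • v j)) j (-t⁻¹ • v i)) i j t hij
    (by
      rw [Function.update_self, Function.update_of_ne hij, Function.update_self,
        Function.update_comm hij.symm, Function.update_idem]
      congr 2
      rw [smul_smul, mul_neg, mul_inv_cancel₀ ht]
      module) h2
  exact ⟨h3, e3.trans (e2.trans e1)⟩

/-- Two swaps, with parameters `t⁻¹` and `-1`: `(vᵢ, vⱼ) ↦ (t⁻¹ vⱼ, -t vᵢ) ↦ (t vᵢ, t⁻¹ vⱼ)`. -/
theorem boxClass_rescale {v : Fin r → V} (hv : LinearIndependent ℝ v) {i j : Fin r}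
    (hij : i ≠ j) {t : ℝ} (ht : t ≠ 0) :
    boxClass (Function.update (Function.update v i (t • v i)) j (t⁻¹ • v j)) = boxClass v := by
  obtain ⟨h1, e1⟩ := boxClass_swap hv hij (inv_ne_zero ht)
  obtain ⟨-, e2⟩ := boxClass_swap h1 hij (neg_ne_zero.2 one_ne_zero)
  rw [← e1, ← e2]
  congr 1
  funext m
  rcases eq_or_ne m i with rfl | hmi
  · simp [hij]
  · rcases eq_or_ne m j with rfl | hmj
    · simp [hij]
    · simp [hmi, hmj]

/-- All side lengths of a half-open box can be moved into the first one. -/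
theorem boxClass_smul_eq_prod {v : Fin (r + 1) → V} (hv : LinearIndependent ℝ v)
    {c : Fin (r + 1) → ℝ} (hc : ∀ i, 0 < c i) :
    boxClass (fun k => c k • v k) =
      boxClass (fun k => Function.update (1 : Fin (r + 1) → ℝ) 0 (∏ i, c i) k • v k) := by
  obtain ⟨ℓ, hℓ⟩ := exists_isDual hv
  -- `s` is the set of edges already reduced to factor `1`, their factors having been transferred to
  -- edge `0`.
  have key : ∀ s : Finset (Fin (r + 1)), 0 ∉ s →
      boxClass (fun k => c k • v k) = boxClass (fun k =>
        (if k = 0 then c 0 * ∏ i ∈ s, c i else if k ∈ s then 1 else c k) • v k) := by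
    intro s
    induction s using Finset.induction_on with
    | empty =>
      intro _
      congr 1
      funext k
      rcases eq_or_ne k 0 with rfl | hk <;> simp [*]
    | insert j s hj ih =>
      intro h0
      rw [Finset.mem_insert, not_or] at h0
      rw [ih h0.2]
      have hne : ∀ k, (if k = 0 then c 0 * ∏ i ∈ s, c i else if k ∈ s then 1 else c k) ≠ 0 := by
        intro k
        split_ifs
        · exact mul_ne_zero (hc 0).ne' (Finset.prod_ne_zero_iff.2 fun i _ => (hc i).ne')
        · exact one_ne_zero
        · exact (hc k).ne'
      rw [← boxClass_rescale (hℓ.smul hne).linearIndependent h0.1 (hc j).ne']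
      congr 1
      funext k
      rcases eq_or_ne k j with rfl | hkj
      · simp [Ne.symm h0.1, hj, smul_smul, (hc k).ne']
      · rcases eq_or_ne k 0 with rfl | hk0
        · simp [h0.1, smul_smul, Finset.prod_insert hj, mul_left_comm]
        · simp [hk0, hkj]
  rw [key (Finset.univ.erase 0) (by simp)]
  congr 1
  funext k
  rcases eq_or_ne k 0 with rfl | hk
  · simp [Finset.mul_prod_erase]
  · simp [hk]

omit [FiniteDimensional ℝ V] in
theorem exists_isometry_map_eq {n : ℕ} (b : OrthonormalBasis (Fin n) ℝ V) (h : r ≤ n)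
    {u : Fin r → V} (hu : Orthonormal ℝ u) :
    ∃ g : V ≃ₗᵢ[ℝ] V, g ∘ u = b ∘ Fin.castLE h := by
  have : FiniteDimensional ℝ V := b.toBasis.finiteDimensional_of_finite
  let u' : Fin n → V := fun i => if hi : (i : ℕ) < r then u ⟨i, hi⟩ else 0
  let s : Set (Fin n) := {i | (i : ℕ) < r}
  have hs : Orthonormal ℝ (s.domRestrict u') := by
    have : s.domRestrict u' = u ∘ fun i : s => (⟨i.1, i.2⟩ : Fin r) := by
      funext i
      have hi : ((i : Fin n) : ℕ) < r := i.2
      rw [Set.domRestrict_apply, Function.comp_apply]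
      exact dif_pos hi
    rw [this]
    refine hu.comp _ fun i j hij => ?_
    rw [Fin.mk.injEq] at hij
    exact Subtype.ext (Fin.ext hij)
  obtain ⟨b', hb'⟩ := hs.exists_orthonormalBasis_extension_of_card_eq
    (Module.finrank_eq_card_basis b.toBasis)
  refine ⟨b'.equiv b (Equiv.refl _), funext fun i => ?_⟩
  have hi : b' (Fin.castLE h i) = u i := by
    rw [hb' _ (show ((Fin.castLE h i : Fin n) : ℕ) < r from i.2)]
    simp [u']
  rw [Function.comp_apply, ← hi, OrthonormalBasis.equiv_apply_basis]
  rfl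

/-- The lengths `c` are the norms of the Gram–Schmidt vectors; an isometry takes their directions to
the first vectors of `b`. -/
theorem exists_boxClass_eq {n : ℕ} (b : OrthonormalBasis (Fin n) ℝ V) (h : r ≤ n)
    {v : Fin r → V} (hv : LinearIndependent ℝ v) :
    ∃ c : Fin r → ℝ, (∀ i, 0 < c i) ∧
      boxClass v = boxClass (fun k => c k • (b ∘ Fin.castLE h) k) := by
  have hu := InnerProductSpace.gramSchmidtNormed_orthonormal hv
  obtain ⟨g, hg⟩ := exists_isometry_map_eq b h hu
  have hpos : ∀ i, 0 < ‖InnerProductSpace.gramSchmidt ℝ v i‖ := fun i =>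
    norm_pos_iff.2 (InnerProductSpace.gramSchmidt_ne_zero i hv)
  refine ⟨_, hpos, ?_⟩
  rw [← boxClass_gramSchmidt hv,
    ← boxClass_isometry g (InnerProductSpace.gramSchmidt_linearIndependent hv)]
  congr 1
  funext k
  rw [← hg, Function.comp_apply, Function.comp_apply, ← map_smul,
    InnerProductSpace.gramSchmidtNormed, smul_smul]
  simp [(hpos k).ne']

end NormalForm

/-! ### Intrinsic volumes of half-open boxes -/

section Values

open MeasureTheory Metric

variable {V : Type*} [NormedAddCommGroup V] [InnerProductSpace ℝ V] [FiniteDimensional ℝ V]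
  {r m : ℕ}

/-- The edges are doubled one at a time, each doubling giving two copies. For closed boxes terms of
lower dimension would appear. -/
theorem boxClass_two_smul {v : Fin r → V} (hv : LinearIndependent ℝ v) :
    boxClass (fun k => (2 : ℝ) • v k) = 2 ^ r • boxClass v := by
  have key : ∀ s : Finset (Fin r),
      boxClass (fun k => (if k ∈ s then (2 : ℝ) else 1) • v k) = 2 ^ s.card • boxClass v := by
    intro s
    induction s using Finset.induction_on with
    | empty => simp
    | insert i s hi ih =>
      have h1 := boxClass_smul_add hv (c := fun k => if k ∈ s then (2 : ℝ) else 1)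
        (fun k => by split_ifs <;> norm_num) i one_pos one_pos
      have e2 : Function.update (fun k => if k ∈ s then (2 : ℝ) else 1) i (1 + 1) =
          fun k => if k ∈ insert i s then 2 else 1 := by
        funext k
        rcases eq_or_ne k i with rfl | hk
        · simp; norm_num
        · simp [hk]
      have e1 : Function.update (fun k => if k ∈ s then (2 : ℝ) else 1) i 1 =
          fun k => if k ∈ s then 2 else 1 := by
        rw [Function.update_eq_self_iff]
        simp [hi]
      rw [e1, e2] at h1
      rw [h1, ih, Finset.card_insert_of_notMem hi, pow_succ, mul_smul, two_smul, smul_add]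
  simpa using key Finset.univ

variable [MeasurableSpace V] [BorelSpace V]

/-- Half-open parallelotopes have only one nonzero intrinsic volume. -/
theorem intrinsicVolumeHom_boxClass_of_ne {v : Fin r → V} (hv : LinearIndependent ℝ v) {j : ℕ}
    (hj : j ≤ finrank ℝ V) (hjr : j ≠ r) : intrinsicVolumeHom V j (boxClass v) = 0 := by
  have h1 := intrinsicVolumeHom_extClass_smul two_pos hj
    (isPolytopal_partialBox hv fun _ => True)
  rw [smul_partialBox] at h1
  change intrinsicVolumeHom V j (boxClass _) = _ * intrinsicVolumeHom V j (boxClass v) at h1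
  rw [boxClass_two_smul hv, map_nsmul, nsmul_eq_mul] at h1
  push_cast at h1
  -- Doubling the box multiplies `V_j` by `2 ^ j` by homogeneity, and by `2 ^ r` by cutting.
  have h2 : ((2 : ℝ) ^ r - 2 ^ j) * intrinsicVolumeHom V j (boxClass v) = 0 := by
    rw [sub_mul, h1, sub_self]
  refine (mul_eq_zero.1 h2).resolve_left fun h => hjr ?_
  exact (pow_right_injective₀ (a := (2 : ℝ)) two_pos (by norm_num) (sub_eq_zero.1 h)).symm

theorem intrinsicVolume_parallelepiped_of_lt {v : Fin r → V} (hv : LinearIndependent ℝ v) {j : ℕ}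
    (hj : j ≤ finrank ℝ V) (hrj : r < j) : intrinsicVolume j (parallelepiped v) = 0 := by
  have h := extClass_partialBox_mem (intrinsicVolumeHom V j).ker (fun _ _ => True) j
    (fun k hk w hw => intrinsicVolumeHom_boxClass_of_ne hw hj hk.ne') r hrj v hv fun _ => False
  rw [AddMonoidHom.mem_ker, partialBox_false,
    extClass_polytope ⟨_, parallelepiped_mem_polytopes hv⟩, intrinsicVolumeHom_cls] at h
  exact h

/-- The closed and the half-open box differ by classes of boxes of dimension less than `r`, which
`V_r` kills. -/
theorem intrinsicVolume_parallelepiped_eq {v : Fin r → V} (hv : LinearIndependent ℝ v) :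
    intrinsicVolume r (parallelepiped v) = intrinsicVolumeHom V r (boxClass v) := by
  have hr : r ≤ finrank ℝ V := by simpa using hv.fintype_card_le_finrank
  have h := extClass_partialBox_sub_mem (intrinsicVolumeHom V r).ker
    (extClass_partialBox_mem (intrinsicVolumeHom V r).ker (fun _ _ => True) r
      (fun k hk w hw => intrinsicVolumeHom_boxClass_of_ne hw hr hk.ne')) hv
      (fun _ => False) fun _ => True
  rw [AddMonoidHom.mem_ker, partialBox_false,
    extClass_polytope ⟨_, parallelepiped_mem_polytopes hv⟩, map_sub, sub_eq_zero,
    intrinsicVolumeHom_cls] at h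
  exact h

/-- The product of a box in the first coordinates and a ball in the other ones. -/
def boxProdBall (b : OrthonormalBasis (Fin r ⊕ Fin m) ℝ V) (α β : Fin r → ℝ) (ρ : ℝ) : Set V :=
  {x | (∀ i, α i ≤ b.repr x (Sum.inl i) ∧ b.repr x (Sum.inl i) ≤ β i) ∧
    ∑ k, b.repr x (Sum.inr k) ^ 2 ≤ ρ ^ 2}

theorem volume_boxProdBall (b : OrthonormalBasis (Fin r ⊕ Fin m) ℝ V) {α β : Fin r → ℝ}
    (hαβ : ∀ i, α i ≤ β i) {ρ : ℝ} (hρ : 0 ≤ ρ) :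
    volume.real (boxProdBall b α β ρ) = (∏ i, (β i - α i)) * (ρ ^ m * ballVolume m) ∧
      volume (boxProdBall b α β ρ) ≠ ⊤ := by
  let D : Set (Fin m → ℝ) := WithLp.toLp 2 ⁻¹' closedBall (0 : EuclideanSpace ℝ (Fin m)) ρ
  have hD : MeasurableSet D :=
    (PiLp.volume_preserving_toLp (Fin m)).measurable isClosed_closedBall.measurableSet
  have hvD : volume D = volume (closedBall (0 : EuclideanSpace ℝ (Fin m)) ρ) :=
    (PiLp.volume_preserving_toLp (Fin m)).measure_preimage
      isClosed_closedBall.measurableSet.nullMeasurableSet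
  have hf := (volume_measurePreserving_sumPiEquivProdPi (fun _ : Fin r ⊕ Fin m => ℝ)).comp
    ((PiLp.volume_preserving_ofLp (Fin r ⊕ Fin m)).comp b.measurePreserving_repr)
  have hS : boxProdBall b α β ρ = ((MeasurableEquiv.sumPiEquivProdPi fun _ : Fin r ⊕ Fin m => ℝ) ∘
      (WithLp.ofLp ∘ b.repr)) ⁻¹' (Set.Icc α β ×ˢ D) := by
    ext x
    simp only [Set.mem_preimage, Set.mem_prod, Set.mem_Icc, Pi.le_def, boxProdBall, D,
      mem_closedBall_zero_iff, Set.mem_ofPred_eq, ← forall_and]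
    refine and_congr Iff.rfl ?_
    rw [← sq_le_sq₀ (norm_nonneg _) hρ, EuclideanSpace.norm_sq_eq]
    simp only [Real.norm_eq_abs, sq_abs]
    rfl
  have hvol : volume (boxProdBall b α β ρ) = volume (Set.Icc α β) *
      volume (closedBall (0 : EuclideanSpace ℝ (Fin m)) ρ) := by
    rw [hS, hf.measure_preimage (measurableSet_Icc.prod hD).nullMeasurableSet, ← hvD]
    exact Measure.prod_prod _ _
  refine ⟨?_, ?_⟩
  · rw [measureReal_def, hvol, ENNReal.toReal_mul, Real.volume_Icc_pi_toReal (fun i => hαβ i),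
      ← measureReal_def, Measure.addHaar_real_closedBall' volume _ hρ, finrank_euclideanSpace_fin]
    rfl
  · rw [hvol]
    exact ENNReal.mul_ne_top isCompact_Icc.measure_ne_top
      (isCompact_closedBall _ _).measure_ne_top

omit [FiniteDimensional ℝ V] [MeasurableSpace V] [BorelSpace V] in
theorem mem_parallelepiped_smul_basis (b : OrthonormalBasis (Fin r ⊕ Fin m) ℝ V)
    {l : Fin r → ℝ} (hl : ∀ i, 0 < l i) (x : V) :
    x ∈ parallelepiped (fun i => l i • b (Sum.inl i)) ↔
      (∀ i, 0 ≤ b.repr x (Sum.inl i) ∧ b.repr x (Sum.inl i) ≤ l i) ∧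
        ∀ k, b.repr x (Sum.inr k) = 0 := by
  rw [mem_parallelepiped_iff]
  constructor
  · rintro ⟨t, ht, rfl⟩
    have h1 : ∀ i, b.repr (∑ i, t i • l i • b (Sum.inl i)) (Sum.inl i) = t i * l i := by
      intro i
      simp [map_sum, Finset.sum_apply, Pi.single_apply]
    have h2 : ∀ k, b.repr (∑ i, t i • l i • b (Sum.inl i)) (Sum.inr k) = 0 := by
      intro k
      simp [map_sum, Finset.sum_apply]
    refine ⟨fun i => ?_, h2⟩
    rw [h1]
    exact ⟨mul_nonneg (ht.1 i) (hl i).le, mul_le_of_le_one_left (hl i).le (ht.2 i)⟩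
  · rintro ⟨h1, h2⟩
    refine ⟨fun i => b.repr x (Sum.inl i) / l i, ⟨fun i => div_nonneg (h1 i).1 (hl i).le,
      fun i => (div_le_one (hl i)).2 (h1 i).2⟩, ?_⟩
    conv_lhs => rw [← b.sum_repr x]
    rw [Fintype.sum_sum_type]
    simp [h2, smul_smul, (hl _).ne']

omit [FiniteDimensional ℝ V] [MeasurableSpace V] [BorelSpace V] in
theorem sum_repr_sq (b : OrthonormalBasis (Fin r ⊕ Fin m) ℝ V) (y : V) :
    ∑ i, b.repr y (Sum.inl i) ^ 2 + ∑ k, b.repr y (Sum.inr k) ^ 2 = ‖y‖ ^ 2 := by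
  rw [← b.repr.norm_map y, EuclideanSpace.norm_sq_eq, Fintype.sum_sum_type]
  simp

omit [FiniteDimensional ℝ V] [MeasurableSpace V] [BorelSpace V] in
-- With `subset_boxProdBall`, this encloses the parallel body between two products of a box and an
-- `m`-ball of radius `ρ`, whose volumes agree to leading order `ρ ^ m` as `ρ → 0`.
theorem boxProdBall_subset (b : OrthonormalBasis (Fin r ⊕ Fin m) ℝ V)
    {l : Fin r → ℝ} (hl : ∀ i, 0 < l i) {ρ : ℝ} (hρ : 0 ≤ ρ) :
    boxProdBall b 0 l ρ ⊆
      parallelepiped (fun i => l i • b (Sum.inl i)) + closedBall (0 : V) ρ := by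
  rintro x ⟨hx1, hx2⟩
  let c : V := ∑ i, b.repr x (Sum.inl i) • b (Sum.inl i)
  have h1 : ∀ i, b.repr c (Sum.inl i) = b.repr x (Sum.inl i) := by
    intro i
    simp [c, map_sum, Finset.sum_apply, Pi.single_apply]
  have h2 : ∀ k, b.repr c (Sum.inr k) = 0 := by
    intro k
    simp [c, map_sum, Finset.sum_apply]
  refine ⟨c, (mem_parallelepiped_smul_basis b hl c).2 ⟨fun i => ?_, h2⟩, x - c, ?_,
    add_sub_cancel _ _⟩
  · rw [h1]
    exact hx1 i
  · rw [mem_closedBall_zero_iff, ← sq_le_sq₀ (norm_nonneg _) hρ, ← sum_repr_sq b]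
    simpa [map_sub, h1, h2] using hx2

omit [FiniteDimensional ℝ V] [MeasurableSpace V] [BorelSpace V] in
theorem subset_boxProdBall (b : OrthonormalBasis (Fin r ⊕ Fin m) ℝ V)
    {l : Fin r → ℝ} (hl : ∀ i, 0 < l i) {ρ : ℝ} (hρ : 0 ≤ ρ) :
    parallelepiped (fun i => l i • b (Sum.inl i)) + closedBall (0 : V) ρ ⊆
      boxProdBall b (fun _ => -ρ) (fun i => l i + ρ) ρ := by
  rintro _ ⟨c, hc, y, hy, rfl⟩
  obtain ⟨h1, h2⟩ := (mem_parallelepiped_smul_basis b hl c).1 hc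
  rw [mem_closedBall_zero_iff] at hy
  have hsq : ‖y‖ ^ 2 ≤ ρ ^ 2 := (sq_le_sq₀ (norm_nonneg _) hρ).2 hy
  rw [← sum_repr_sq b] at hsq
  have h3 : 0 ≤ ∑ k, b.repr y (Sum.inr k) ^ 2 := Finset.sum_nonneg fun _ _ => sq_nonneg _
  have h4 : 0 ≤ ∑ i, b.repr y (Sum.inl i) ^ 2 := Finset.sum_nonneg fun _ _ => sq_nonneg _
  refine ⟨fun i => ?_, ?_⟩
  · have h5 : b.repr y (Sum.inl i) ^ 2 ≤ ∑ i, b.repr y (Sum.inl i) ^ 2 :=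
      Finset.single_le_sum (f := fun i => b.repr y (Sum.inl i) ^ 2) (fun _ _ => sq_nonneg _)
        (Finset.mem_univ i)
    have h6 := abs_le_of_sq_le_sq' (by linarith : b.repr y (Sum.inl i) ^ 2 ≤ ρ ^ 2) hρ
    have e : b.repr (c + y) (Sum.inl i) = b.repr c (Sum.inl i) + b.repr y (Sum.inl i) := by
      rw [map_add]; rfl
    change -ρ ≤ b.repr (c + y) (Sum.inl i) ∧ b.repr (c + y) (Sum.inl i) ≤ l i + ρ
    rw [e]
    exact ⟨by linarith [h1 i], by linarith [h1 i]⟩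
  · have e : ∀ k, b.repr (c + y) (Sum.inr k) = b.repr y (Sum.inr k) := fun k => by
      rw [map_add, PiLp.add_apply, h2, zero_add]
    change ∑ k, b.repr (c + y) (Sum.inr k) ^ 2 ≤ ρ ^ 2
    simp only [e]
    linarith

/-- As `V_j` vanishes on the box for `j > r`, Steiner's polynomial is divisible by `ρ ^ m`. The
quotient `q` satisfies `q 0 = κ_m V_r`, and the two inclusions squeeze `q ρ` between `κ_m ∏ lᵢ` and
`κ_m ∏ (lᵢ + 2ρ)`. The lower intrinsic volumes need not be computed. -/
theorem intrinsicVolume_box_sum (b : OrthonormalBasis (Fin r ⊕ Fin m) ℝ V) {l : Fin r → ℝ}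
    (hl : ∀ i, 0 < l i) :
    intrinsicVolume r (parallelepiped fun i => l i • b (Sum.inl i)) = ∏ i, l i := by
  have hn : finrank ℝ V = r + m := by
    rw [finrank_eq_card_basis b.toBasis]; simp
  have hli : LinearIndependent ℝ fun i => l i • b (Sum.inl i) := by
    exact linearIndependent_smul (b.orthonormal.linearIndependent.comp _ Sum.inl_injective)
      fun i => (hl i).ne'
  have hC := parallelepiped_mem_polytopes hli
  set C := parallelepiped fun i => l i • b (Sum.inl i)
  let q : ℝ → ℝ := fun ρ => ∑ j ∈ Finset.range (r + 1),
    ballVolume (r + m - j) * intrinsicVolume j C * ρ ^ (r - j)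
  have hq : ∀ ρ, 0 ≤ ρ → volume.real (C + closedBall (0 : V) ρ) = ρ ^ m * q ρ := by
    intro ρ hρ
    rw [steiner_formula hC hρ, hn, Finset.mul_sum]
    symm
    refine Finset.sum_subset_zero_on_sdiff
      (Finset.range_subset_range.2 (by omega)) (fun j hj => ?_) fun j hj => ?_
    · simp only [Finset.mem_sdiff, Finset.mem_range] at hj
      rw [intrinsicVolume_parallelepiped_of_lt hli (by omega) (by omega)]
      simp
    · have hj' : j ≤ r := by simpa [Nat.lt_succ_iff] using hj
      rw [show r + m - j = m + (r - j) by omega, pow_add]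
      ring
  have hlow : ∀ ρ, 0 < ρ → (∏ i, l i) * ballVolume m ≤ q ρ := by
    intro ρ hρ
    obtain ⟨h1, -⟩ := volume_boxProdBall b (α := 0) (fun i => (hl i).le) hρ.le
    have h2 := measureReal_mono (μ := volume) (boxProdBall_subset b hl hρ.le)
      ((isCompact_of_isClosed_isBounded (polytope_isClosed hC) hC.1).add
        (isCompact_closedBall 0 ρ)).measure_ne_top
    rw [h1, hq ρ hρ.le] at h2
    simp only [Pi.zero_apply, sub_zero] at h2
    have := pow_pos hρ m
    rw [mul_left_comm] at h2
    exact le_of_mul_le_mul_left h2 this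
  have hup : ∀ ρ, 0 < ρ → q ρ ≤ (∏ i, (l i + 2 * ρ)) * ballVolume m := by
    intro ρ hρ
    obtain ⟨h1, h3⟩ := volume_boxProdBall b (α := fun _ => -ρ) (β := fun i => l i + ρ)
      (fun i => by linarith [hl i]) hρ.le
    have h2 := measureReal_mono (μ := volume) (subset_boxProdBall b hl hρ.le) h3
    rw [h1, hq ρ hρ.le] at h2
    have := pow_pos hρ m
    rw [mul_left_comm] at h2
    have e : ∏ i, (l i + ρ - -ρ) = ∏ i, (l i + 2 * ρ) :=
      Finset.prod_congr rfl fun i _ => by ring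
    rw [e] at h2
    exact le_of_mul_le_mul_left h2 this
  have hq0 : q 0 = ballVolume m * intrinsicVolume r C := by
    simp only [q]
    rw [Finset.sum_eq_single_of_mem r (Finset.self_mem_range_succ r)]
    · simp
    · intro j hj hjr
      rw [Finset.mem_range] at hj
      rw [zero_pow (by omega), mul_zero]
  have hqc : Filter.Tendsto q (nhdsWithin 0 (Set.Ioi 0)) (nhds (q 0)) := by
    have : Continuous q := by fun_prop
    exact this.continuousWithinAt
  have huc : Filter.Tendsto (fun ρ : ℝ => (∏ i, (l i + 2 * ρ)) * ballVolume m)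
      (nhdsWithin 0 (Set.Ioi 0)) (nhds ((∏ i, (l i + 2 * 0)) * ballVolume m)) := by
    have : Continuous fun ρ : ℝ => (∏ i, (l i + 2 * ρ)) * ballVolume m := by fun_prop
    exact this.continuousWithinAt
  have h1 := ge_of_tendsto hqc (Filter.eventually_of_mem self_mem_nhdsWithin hlow)
  have h2 := le_of_tendsto_of_tendsto hqc huc (Filter.eventually_of_mem self_mem_nhdsWithin hup)
  simp only [mul_zero, add_zero] at h2
  have h3 := le_antisymm h2 h1
  rw [hq0, mul_comm] at h3
  exact mul_right_cancel₀ (ballVolume_pos m).ne' h3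

/-- The `r`-th intrinsic volume of an `r`-dimensional half-open rectangular box. -/
theorem intrinsicVolumeHom_boxClass (b : OrthonormalBasis (Fin (finrank ℝ V)) ℝ V)
    (h : r ≤ finrank ℝ V) {l : Fin r → ℝ} (hl : ∀ i, 0 < l i) :
    intrinsicVolumeHom V r (boxClass fun k => l k • (b ∘ Fin.castLE h) k) = ∏ i, l i := by
  -- Splits the indices of the basis into the first `r` and the remaining `n - r`.
  let b' := b.reindex ((finCongr (Nat.add_sub_cancel' h).symm).trans finSumFinEquiv.symm)
  have hb' : ∀ i, b' (Sum.inl i) = (b ∘ Fin.castLE h) i := fun i => by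
    simp only [b', OrthonormalBasis.reindex_apply, Function.comp_apply]
    congr 1
  have hli : LinearIndependent ℝ fun k => l k • (b ∘ Fin.castLE h) k := by
    exact linearIndependent_smul
      (b.orthonormal.linearIndependent.comp _ (Fin.castLE_injective h)) fun i => (hl i).ne'
  rw [← intrinsicVolume_parallelepiped_eq hli, ← intrinsicVolume_box_sum b' hl]
  simp only [hb']

end Values

/-! ### Parametrization of `K_𝒵(V)` by `ℤ × ℝⁿ` -/

section Classification

/-- Every real is a difference of positive ones, so `F x = f (x + s) - f s` for any `s` with `s` and
`x + s` positive; `s = |x| + 1` is such a choice. -/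
theorem exists_addMonoidHom_of_pos {A : Type*} [AddCommGroup A] (f : ℝ → A)
    (hf : ∀ a b : ℝ, 0 < a → 0 < b → f (a + b) = f a + f b) :
    ∃ F : ℝ →+ A, ∀ a, 0 < a → F a = f a := by
  have h1 : ∀ x : ℝ, 0 < |x| + 1 := fun x => by positivity
  have h2 : ∀ x : ℝ, 0 < x + (|x| + 1) := fun x => by linarith [neg_abs_le x]
  refine ⟨AddMonoidHom.mk' (fun x => f (x + (|x| + 1)) - f (|x| + 1)) fun x y => ?_,
    fun a ha => ?_⟩
  · have h3 : f (x + y + (|x + y| + 1)) + f (|x| + 1) + f (|y| + 1) =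
        f (|x + y| + 1) + f (x + (|x| + 1)) + f (y + (|y| + 1)) := by
      rw [← hf _ _ (h2 _) (h1 _), ← hf _ _ (add_pos (h2 _) (h1 _)) (h1 _),
        ← hf _ _ (h1 _) (h2 _), ← hf _ _ (add_pos (h1 _) (h2 _)) (h2 _)]
      congr 1
      ring
    rw [sub_add_sub_comm, sub_eq_sub_iff_add_eq_add]
    rw [← add_assoc, h3]
    abel
  · change f (a + (|a| + 1)) - f (|a| + 1) = f a
    rw [hf _ _ ha (h1 a), add_sub_cancel_right]

theorem exists_pos_sub_eq (x : ℝ) : ∃ a b : ℝ, 0 < a ∧ 0 < b ∧ x = a - b :=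
  ⟨x + (|x| + 1), |x| + 1, by linarith [neg_abs_le x], by positivity, by ring⟩

variable {V : Type*} [NormedAddCommGroup V] [InnerProductSpace ℝ V] [FiniteDimensional ℝ V]

/-- The class of a half-open box is additive in the length of its first edge, hence extends to a
morphism from `ℝ`. -/
theorem exists_slabHom {r : ℕ} {v : Fin (r + 1) → V} (hv : LinearIndependent ℝ v) :
    ∃ F : ℝ →+ PolytopeGroup V, (∀ a, 0 < a →
      F a = boxClass fun k => Function.update (1 : Fin (r + 1) → ℝ) 0 a k • v k) ∧
      ∀ a, F a ∈ parallelotopeSubgroup V := by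
  obtain ⟨F, hF⟩ := exists_addMonoidHom_of_pos
    (fun a => boxClass fun k => Function.update (1 : Fin (r + 1) → ℝ) 0 a k • v k)
    (fun a b ha hb => boxClass_smul_add hv (fun _ => one_pos) 0 ha hb)
  have hpos : ∀ a, 0 < a → F a ∈ parallelotopeSubgroup V := by
    intro a ha
    rw [hF a ha]
    refine boxClass_mem_parallelotopeSubgroup (linearIndependent_smul hv fun k => ?_)
    rcases eq_or_ne k 0 with rfl | hk
    · simpa using ha.ne'
    · simp [hk]
  refine ⟨F, hF, fun x => ?_⟩
  obtain ⟨a, b, ha, hb, rfl⟩ := exists_pos_sub_eq x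
  rw [map_sub]
  exact sub_mem (hpos a ha) (hpos b hb)

variable [MeasurableSpace V] [BorelSpace V]

variable (V) in
/-- The group `ℤ × ℝⁿ` parametrizes `K_𝒵(V)`, the parameters being the intrinsic volumes. -/
theorem exists_parametrization :
    ∃ Ψ : ℤ × (Fin (finrank ℝ V) → ℝ) →+ PolytopeGroup V,
      Ψ.range = parallelotopeSubgroup V ∧
      ∀ x, intrinsicVolumeHom V 0 (Ψ x) = x.1 ∧
        ∀ i : Fin (finrank ℝ V), intrinsicVolumeHom V (i + 1) (Ψ x) = x.2 i := by
  let b := stdOrthonormalBasis ℝ V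
  have hframe : ∀ {r : ℕ} (h : r ≤ finrank ℝ V), LinearIndependent ℝ (b ∘ Fin.castLE h) :=
    fun h => b.orthonormal.linearIndependent.comp _ (Fin.castLE_injective h)
  -- The index is shifted: `F i` comes from boxes of dimension `i + 1`, dimension `0` being
  -- represented by `pt`.
  choose F hF hFmem using fun i : Fin (finrank ℝ V) =>
    exists_slabHom (hframe (r := (i : ℕ) + 1) i.2)
  let pt : PolytopeGroup V := boxClass (Fin.elim0 : Fin 0 → V)
  have hpt : ∀ v : Fin 0 → V, boxClass v = pt := fun v => by rw [Subsingleton.elim v Fin.elim0]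
  have hpt0 : intrinsicVolumeHom V 0 pt = 1 := by
    have := intrinsicVolumeHom_boxClass b (Nat.zero_le _) (l := fun _ : Fin 0 => 1)
      fun _ => one_pos
    rw [hpt] at this
    simpa using this
  have hli : LinearIndependent ℝ (Fin.elim0 : Fin 0 → V) := linearIndependent_empty_type
  have hptj : ∀ j, j ≤ finrank ℝ V → j ≠ 0 → intrinsicVolumeHom V j pt = 0 :=
    fun j hj hj0 => intrinsicVolumeHom_boxClass_of_ne hli hj hj0
  -- The intrinsic volumes are diagonal on the families `pt` and `F i`. This is computed for `c >
  -- 0`, where `F i c` is the class of a box, and extended by differences.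
  have hFj : ∀ i : Fin (finrank ℝ V), ∀ j ≤ finrank ℝ V, ∀ c,
      intrinsicVolumeHom V j (F i c) = if j = i + 1 then c else 0 := by
    intro i j hj
    have hpos : ∀ c, 0 < c → intrinsicVolumeHom V j (F i c) = if j = i + 1 then c else 0 := by
      intro c hc
      have hup : ∀ k, 0 < Function.update (1 : Fin ((i : ℕ) + 1) → ℝ) 0 c k := fun k => by
        rcases eq_or_ne k 0 with rfl | hk
        · simpa using hc
        · simp [hk]
      rw [hF i c hc]
      split_ifs with hji
      · subst hji
        rw [intrinsicVolumeHom_boxClass b i.2 hup, Finset.prod_update_of_mem (Finset.mem_univ _)]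
        simp
      · exact intrinsicVolumeHom_boxClass_of_ne
          (linearIndependent_smul (hframe i.2) fun k => (hup k).ne') hj hji
    intro x
    obtain ⟨a, b, ha, hb, rfl⟩ := exists_pos_sub_eq x
    rw [map_sub, map_sub, hpos a ha, hpos b hb]
    split_ifs <;> simp
  let Ψ : ℤ × (Fin (finrank ℝ V) → ℝ) →+ PolytopeGroup V :=
    (zmultiplesHom _ pt).coprod (∑ i, (F i).comp (Pi.evalAddMonoidHom _ i))
  have hΨ : ∀ x, Ψ x = x.1 • pt + ∑ i, F i (x.2 i) := fun x => by
    simp [Ψ, AddMonoidHom.coprod_apply, AddMonoidHom.finsetSum_apply]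
  refine ⟨Ψ, le_antisymm ?_ (parallelotopeSubgroup_le _ ?_), fun x => ⟨?_, fun i => ?_⟩⟩
  · rintro _ ⟨x, rfl⟩
    rw [hΨ]
    exact add_mem (zsmul_mem (boxClass_mem_parallelotopeSubgroup hli) _)
      (sum_mem fun i _ => hFmem i _)
  -- Surjectivity: a half-open box of positive dimension equals the standard one having as first
  -- edge the product of its lengths, and so lies in the image of some `F i`.
  · intro r v hv
    have hr : r ≤ finrank ℝ V := by simpa using hv.fintype_card_le_finrank
    rcases r with _ | r
    · exact ⟨(1, 0), by rw [hΨ, hpt]; simp⟩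
    · obtain ⟨c, hc, hcv⟩ := exists_boxClass_eq b hr hv
      refine ⟨(0, Pi.single ⟨r, hr⟩ (∏ i, c i)), ?_⟩
      rw [hΨ, hcv, boxClass_smul_eq_prod (hframe hr) hc,
        ← hF ⟨r, hr⟩ _ (Finset.prod_pos fun i _ => hc i), zero_smul, zero_add]
      rw [Finset.sum_eq_single_of_mem _ (Finset.mem_univ ⟨r, hr⟩)]
      · simp only [Pi.single_eq_same]
      · intro k _ hk
        simp only [Pi.single_eq_of_ne hk, map_zero]
  · rw [hΨ, map_add, map_zsmul, map_sum, hpt0,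
      Finset.sum_eq_zero fun i _ => by rw [hFj i 0 (Nat.zero_le _), if_neg (by omega)]]
    simp
  · rw [hΨ, map_add, map_zsmul, map_sum, hptj _ i.2 (Nat.succ_ne_zero _)]
    simp [hFj _ _ (Nat.succ_le_of_lt i.2), ← Fin.ext_iff]

end Classification

end Dissection

end

theorem theorem4p1 {V : Type*} [NormedAddCommGroup V] [InnerProductSpace ℝ V]
    [FiniteDimensional ℝ V] [MeasurableSpace V] [BorelSpace V] :
    (∃ e : Dissection.parallelotopeSubgroup V ≃+ ℤ × (Fin (Module.finrank ℝ V) → ℝ),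
      ∀ x : Dissection.parallelotopeSubgroup V,
        ((e x).1 : ℝ) = Dissection.intrinsicVolumeHom V 0 (x : Dissection.PolytopeGroup V) ∧
        ∀ i : Fin (Module.finrank ℝ V), (e x).2 i =
          Dissection.intrinsicVolumeHom V ((i : ℕ) + 1) (x : Dissection.PolytopeGroup V)) ∧
    ∀ P ∈ Dissection.parallelotopesExt V, ∀ P' ∈ Dissection.parallelotopesExt V,
      (∀ i : ℕ, i ≤ Module.finrank ℝ V →
        Dissection.intrinsicVolumeHom V i (Dissection.extClass P) =
          Dissection.intrinsicVolumeHom V i (Dissection.extClass P')) →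
      Dissection.extClass P = Dissection.extClass P' := by
  obtain ⟨Ψ, hrange, hΨ⟩ := Dissection.exists_parametrization V
  have hinj : Function.Injective Ψ := by
    intro x y hxy
    refine Prod.ext ?_ (funext fun i => ?_)
    · have h := (hΨ x).1
      rw [hxy, (hΨ y).1] at h
      exact_mod_cast h.symm
    · rw [← (hΨ x).2 i, hxy, (hΨ y).2 i]
  refine ⟨?_, ?_⟩
  · rw [← hrange]
    -- The isomorphism is the inverse of `Ψ` onto its range; `V₀` is integral because the first
    -- factor of the source is `ℤ`.
    refine ⟨(AddMonoidHom.ofInjective hinj).symm, fun x => ?_⟩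
    obtain ⟨y, rfl⟩ := (AddMonoidHom.ofInjective hinj).surjective x
    rw [AddEquiv.symm_apply_apply, AddMonoidHom.ofInjective_apply]
    exact ⟨(hΨ y).1.symm, fun i => ((hΨ y).2 i).symm⟩
  · intro P hP P' hP' h
    obtain ⟨x, hx⟩ : Dissection.extClass P ∈ Ψ.range := hrange ▸ hP.2
    obtain ⟨y, hy⟩ : Dissection.extClass P' ∈ Ψ.range := hrange ▸ hP'.2
    rw [← hx, ← hy] at h ⊢
    congr 1
    refine Prod.ext ?_ (funext fun i => ?_)
    · have h0 := h 0 (Nat.zero_le _)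
      rw [(hΨ x).1, (hΨ y).1] at h0
      exact_mod_cast h0
    · rw [← (hΨ x).2 i, ← (hΨ y).2 i]
      exact h _ i.2
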